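/- **Setting.** There are $N\ge 1$ arms with $M\ge 1$ attributes each, and a threshold $\mu_{\rm TH}$. An instance is a family $\nu=(\nu_{ij})$ of probability laws on $[0,1]$; all rewards $X_{ij}(t)\sim\nu_{ij}$ are independent. Put $\mu_{ij}=\mathbb E X_{ij}(t)$ and $\mu_i=\frac1M\sum_j\mu_{ij}$. The feasible set is $\mathcal F=\{i:\min_j\mu_{ij}\ge\mu_{\rm TH}\}$. If $\mathcal F\neq\emptyset$, the best arm $i^\star$ is the maximizer of $\mu_i$ over $\mathcal F$. The instance is *regular* if $\mathcal F=\emptyset$, or if $i^\star$ is unique and $\min_j\mu_{i^\star j}\ne\mu_{\rm TH}$. If $\mathcal F\ne\emptyset$ let $\mathcal S=\{i:\mu_i<\mu_{i^\star}\}$ and $\mathcal R=[N]\setminus(\mathcal S\cup\{i^\star\})$; if $\mathcal F=\emptyset$ let $\mathcal S=\emptyset$ and $\mathcal R=[N]$. Put $\Delta_i=|\mu_{i^\star}-\mu_i|$ for $i\in\mathcal S$, $\Delta_{i^\star}=|\mu_{i^\star}-\max_{i\in\mathcal S}\mu_i|$ ($=+\infty$ if $\mathcal S=\emptyset$), $\Delta_i^{\rm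 attr}=|\min_j\mu_{ij}-\mu_{\rm TH}|$, and $$H_{\rm id}=\frac1{\min\{\frac{\Delta_{i^\star}}2,\Delta^{\rm attr}_{i^\star}\}^2}+\sum_{i\in\mathcal F\cap\mathcal S}\frac1{(\Delta_i/2)^2}+\sum_{i\in\mathcal F^c\cap\mathcal R}\frac1{(\Delta_i^{\rm attr})^2}+\sum_{i\in\mathcal F^c\cap\mathcal S}\frac1{\max\{\frac{\Delta_i}2,\Delta_i^{\rm attr}\}^2},$$ where the first term is absent if $\mathcal F=\emptyset$. A (possibly randomized) policy in each round samples one pair (arm, attribute), chosen from its past observations, until it stops, after $\tau$ samples; then it names an arm or declares the instance infeasible. Let $\mathcal D$ be either the set of all laws on $[0,1]$ or the set of all Bernoulli laws. A policy is $\delta$-PAC if, on every regular instance with laws in $\mathcal D$, it stops with the correct answer ($i^\star$, or "infeasible" if $\mathcal F=\emptyset$) with probability at least $1-\delta$. **Theorem (lower bound).** Let $\mu_{\rm TH}<1$, and $\mu_{\rm TH}>0$ or $N\ge2$. For every regular instance $(\nu,\mu_{\rm TH})$ with laws in $\mathcal D$ there is a constant $C=C(\nu,\mu_{\rm TH})>0$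 such that for every $\delta\in(0,1)$ every $\delta$-PAC policy satisfies $$\mathbb E_\nu[\tau]\;\ge\;\ln\Big(\frac1{2.4\,\delta}\Big)\,C(\nu,\mu_{\rm TH})\,H_{\rm id}.$$ Moreover, if all $\nu_{ij}$ are Bernoulli, then $C$ can be chosen with $$C(\nu,\mu_{\rm TH})\ge\tfrac1{32}\,\mu_{\rm TH}(1-\mu_{\rm TH})(1-\mu^\star)^3\,\rho,$$ where $\mu^\star=\mu_{i^\star}$ ($=0$ if $\mathcal F=\emptyset$), $\rho=1$ if $\mathcal S=\emptyset$, and otherwise $\rho=\big(\frac{\Delta_{i^\star}}2\big/\min_{i\in\mathcal S}D_i\big)^2$ with $D_i=\frac{\Delta_i}2$ for $i\in\mathcal F$ and $D_i=\max\{\frac{\Delta_i}2,\Delta_i^{\rm attr}\}$ for $i\notin\mathcal F$ (so $\rho=1$ if an arm with the largest mean in $\mathcal S$ is feasible). -/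

import Mathlib

open MeasureTheory

noncomputable section

namespace GroupedBandit

/-- A reward environment: `ν i j` is the law of the rewards of attribute `j` of arm `i`. -/
abbrev Env (N M : ℕ) := Fin N → Fin M → ProbabilityMeasure ℝ

/-- The laws of rewards with values in `[0, 1]`. -/
def unitLaws : Set (ProbabilityMeasure ℝ) := {p | (p : Measure ℝ) (Set.Icc 0 1) = 1}

/-- The Bernoulli laws: the laws of rewards with values in `{0, 1}`. -/
def bernoulliLaws : Set (ProbabilityMeasure ℝ) := {p | (p : Measure ℝ) {0, 1} = 1}

section Instance

variable {N M : ℕ} [NeZero M] (ν : Env N M) (θ : ℝ)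

/-- `μ_{ij}` -/
def attrMean (i : Fin N) (j : Fin M) : ℝ := ∫ x, x ∂(ν i j : Measure ℝ)

/-- `μ_i`, the average of the attribute means of arm `i`. -/
def armMean (i : Fin N) : ℝ := (∑ j, attrMean ν i j) / M

/-- `min_j μ_{ij}` -/
def minAttrMean (i : Fin N) : ℝ := Finset.univ.inf' Finset.univ_nonempty (attrMean ν i)

/-- The feasible set `F`. -/
def feasible : Set (Fin N) := {i | θ ≤ minAttrMean ν i}

/-- Arm `i` is the unique best feasible arm. -/
def IsBestArm (i : Fin N) : Prop :=
  i ∈ feasible ν θ ∧ ∀ k ∈ feasible ν θ, k ≠ i → armMean ν k < armMean ν i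

/-- The instances with a well-defined answer and a finite hardness index: either no arm is
feasible, or there is a unique best feasible arm and it does not lie on the boundary of
feasibility. -/
def IsRegular : Prop :=
  feasible ν θ = ∅ ∨ ∃ i, IsBestArm ν θ i ∧ minAttrMean ν i ≠ θ

open Classical in
/-- `some i⋆` on a feasible instance, `none` on an infeasible one. It is the correct answer. -/
def bestArm : Option (Fin N) :=
  if h : ∃ i, IsBestArm ν θ i then some h.choose else none

open Classical in
/-- The suboptimal set `S` (empty on an infeasible instance). -/
def subopt : Finset (Fin N) :=
  match bestArm ν θ with
  | none => ∅
  | some b => {i | armMean ν i < armMean ν b}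

/-- The risky set `R`, the complement of `S ∪ {i⋆}`. -/
def risky : Finset (Fin N) :=
  Finset.univ \ (subopt ν θ ∪ (bestArm ν θ).toFinset)

/-- The mean reward of the best feasible arm (`0` on an infeasible instance). -/
def bestMean : ℝ := (bestArm ν θ).elim 0 (armMean ν)

/-- `Δ_i`, for a suboptimal arm `i`. -/
def gap (i : Fin N) : ℝ := |bestMean ν θ - armMean ν i|

/-- `Δ_{i⋆}`, the distance from the mean reward of the best arm to the largest mean reward of a
suboptimal arm. -/
def bestGap (h : (subopt ν θ).Nonempty) : ℝ :=
  |bestMean ν θ - (subopt ν θ).sup' h (armMean ν)|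

/-- `Δ_i^attr` -/
def attrGap (i : Fin N) : ℝ := |minAttrMean ν i - θ|

open Classical in
/-- The term of the best arm in the hardness index; `Δ_{i⋆}` is infinite if no arm is
suboptimal, and there is no such term on an infeasible instance. -/
def bestTerm : ℝ :=
  match bestArm ν θ with
  | none => 0
  | some b =>
    if h : (subopt ν θ).Nonempty then 1 / (min (bestGap ν θ h / 2) (attrGap ν θ b)) ^ 2
    else 1 / attrGap ν θ b ^ 2

open Classical in
/-- The hardness index `H_id`. -/
def hardness : ℝ :=
  bestTerm ν θ
    + ∑ i ∈ (subopt ν θ).filter (· ∈ feasible ν θ), 1 / (gap ν θ i / 2) ^ 2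
    + ∑ i ∈ (risky ν θ).filter (· ∉ feasible ν θ), 1 / attrGap ν θ i ^ 2
    + ∑ i ∈ (subopt ν θ).filter (· ∉ feasible ν θ),
        1 / (max (gap ν θ i / 2) (attrGap ν θ i)) ^ 2

open Classical in
/-- The gap with which a suboptimal arm enters the hardness index: `Δ_i / 2` if it is feasible,
`max (Δ_i / 2) (Δ_i^attr)` if not. -/
def effGap (i : Fin N) : ℝ :=
  if i ∈ feasible ν θ then gap ν θ i / 2 else max (gap ν θ i / 2) (attrGap ν θ i)

open Classical in
/-- The squared ratio of `Δ_{i⋆} / 2` to the least effective gap of a suboptimal arm. It is at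
most `1`, and equal to `1` if the best suboptimal arm is feasible or no arm is suboptimal. -/
def competitorRatio : ℝ :=
  if h : (subopt ν θ).Nonempty then
    ((bestGap ν θ h / 2) / (subopt ν θ).inf' h (effGap ν θ)) ^ 2
  else 1

/-- An explicit constant for Bernoulli rewards. -/
def bernoulliConst : ℝ :=
  θ * (1 - θ) * (1 - bestMean ν θ) ^ 3 / 32 * competitorRatio ν θ

end Instance

/-- What has been observed in the first `t` rounds: the pairs (arm, attribute) that were sampled
and the rewards that were received. -/
abbrev History (N M t : ℕ) := Fin t → (Fin N × Fin M) × ℝ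

/-- A (possibly randomized) policy: a random seed, drawn once and independent of the rewards, a
sampling rule, a stopping rule and a recommendation rule (`some i`: arm `i` is declared to be the
best feasible arm; `none`: the instance is declared to be infeasible). -/
structure Policy (N M : ℕ) where
  Seed : Type
  [seedSpace : MeasurableSpace Seed]
  seedLaw : ProbabilityMeasure Seed
  sample : (t : ℕ) → Seed × History N M t → Fin N × Fin M
  halt : (t : ℕ) → Set (Seed × History N M t)
  output : (t : ℕ) → Seed × History N M t → Option (Fin N)
  measurable_sample : ∀ t, Measurable (sample t)
  measurableSet_halt : ∀ t, MeasurableSet (halt t)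
  measurableSet_output : ∀ t o, MeasurableSet (output t ⁻¹' {o})

attribute [instance] Policy.seedSpace

namespace Policy

variable {N M : ℕ} (π : Policy N M)

/-- The seed, and the table of all rewards `X_{ij}(t)`. -/
abbrev Outcome := π.Seed × (ℕ → Fin N × Fin M → ℝ)

/-- The law of the seed and the rewards under `ν`: all of them are independent, and
`X_{ij}(t) ∼ ν_{ij}`. -/
def law (ν : Env N M) : Measure π.Outcome :=
  (π.seedLaw : Measure π.Seed).prod
    (Measure.infinitePi fun _ : ℕ => Measure.pi fun p : Fin N × Fin M => (ν p.1 p.2 : Measure ℝ))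

/-- The history of the policy; only the reward of the sampled pair is observed. -/
def history (ω : π.Outcome) : (t : ℕ) → History N M t
  | 0 => Fin.elim0
  | t + 1 =>
    let a := π.sample t (ω.1, history ω t)
    Fin.snoc (α := fun _ => (Fin N × Fin M) × ℝ) (history ω t) (a, ω.2 t a)

/-- The number of samples that are taken before the policy stops. -/
def stopTime (ω : π.Outcome) : ℕ∞ :=
  ⨅ (t : ℕ) (_ : (ω.1, π.history ω t) ∈ π.halt t), (t : ℕ∞)

/-- The event that the policy stops and outputs `o`. -/
def outputs (o : Option (Fin N)) : Set π.Outcome :=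
  {ω | ∃ t : ℕ, π.stopTime ω = t ∧ π.output t (ω.1, π.history ω t) = o}

/-- The expected number of samples under `ν`. -/
def expectedSamples (ν : Env N M) : ENNReal := ∫⁻ ω, (π.stopTime ω : ENNReal) ∂(π.law ν)

/-- The policy is `δ`-PAC for the threshold `θ` and rewards with laws in `D`: on every regular
instance it stops with the correct answer with probability at least `1 - δ`. -/
def IsPAC [NeZero M] (D : Set (ProbabilityMeasure ℝ)) (θ δ : ℝ) : Prop :=
  ∀ ν : Env N M, (∀ i j, ν i j ∈ D) → IsRegular ν θ →
    ENNReal.ofReal (1 - δ) ≤ π.law ν (π.outputs (bestArm ν θ))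

end Policy

end GroupedBandit

end

noncomputable section

namespace GroupedBandit

lemma measurable_update_prod {X : Type*} [MeasurableSpace X] (t : ℕ) :
    Measurable fun p : (ℕ → X) × X => Function.update p.1 t p.2 := by
  refine measurable_pi_iff.2 fun i => ?_
  by_cases h : i = t
  · subst h; simpa using measurable_snd
  · simp only [Function.update_of_ne h]; fun_prop

/-- Redrawing one coordinate of a sequence of independent variables does not change the law. -/
lemma infinitePi_prod_map_update {X : Type*} [MeasurableSpace X] (μ : ℕ → Measure X)
    [∀ i, IsProbabilityMeasure (μ i)] (t : ℕ) :
    ((Measure.infinitePi μ).prod (μ t)).map (fun p => Function.update p.1 t p.2) =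
      Measure.infinitePi μ := by
  refine Measure.eq_infinitePi μ fun s B hB => ?_
  have hpre : (fun p : (ℕ → X) × X => Function.update p.1 t p.2) ⁻¹' (Set.pi s B) =
      (Set.pi ↑(s.erase t) B) ×ˢ (if t ∈ s then B t else Set.univ) := by
    ext p
    simp only [Set.mem_preimage, Set.mem_pi, Set.mem_prod, Finset.coe_erase, Set.mem_sdiff,
      Set.mem_singleton_iff, SetLike.mem_coe]
    constructor
    · intro h
      refine ⟨fun i hi => by simpa [Function.update_of_ne hi.2] using h i hi.1, ?_⟩
      split_ifs with ht
      · simpa using h t ht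
      · trivial
    · rintro ⟨h1, h2⟩ i hi
      by_cases hit : i = t
      · subst hit; simpa [hi] using h2
      · simpa [Function.update_of_ne hit] using h1 i ⟨hi, hit⟩
  rw [Measure.map_apply (measurable_update_prod t)
      (MeasurableSet.pi s.countable_toSet fun i _ => hB i), hpre,
    Measure.prod_prod, Measure.infinitePi_pi _ fun i _ => hB i]
  split_ifs with ht
  · exact Finset.prod_erase_mul _ _ ht
  · simp [Finset.erase_eq_of_notMem ht]

namespace Policy

variable {N M : ℕ} (π : Policy N M)

instance (ν : Env N M) : IsProbabilityMeasure (π.law ν) := by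
  unfold law; infer_instance

/-- The seed and the history of the first `t` rounds: all that the policy knows after them. -/
def view (t : ℕ) (ω : π.Outcome) : π.Seed × History N M t := (ω.1, π.history ω t)

/-- The pair that is sampled in round `t`. -/
def action (t : ℕ) (ω : π.Outcome) : Fin N × Fin M := π.sample t (π.view t ω)

/-- What is observed in round `t`. -/
def obs (t : ℕ) (ω : π.Outcome) : (Fin N × Fin M) × ℝ := (π.action t ω, ω.2 t (π.action t ω))

lemma history_succ (ω : π.Outcome) (t : ℕ) :
    π.history ω (t + 1) =
      Fin.snoc (α := fun _ => (Fin N × Fin M) × ℝ) (π.history ω t) (π.obs t ω) := rfl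

lemma history_apply (ω : π.Outcome) (t : ℕ) (i : Fin t) : π.history ω t i = π.obs i ω := by
  induction t with
  | zero => exact i.elim0
  | succ t ih =>
    rw [history_succ]
    refine Fin.lastCases ?_ (fun j => ?_) i
    · simp
    · simpa using ih j

lemma measurable_snoc (t : ℕ) :
    Measurable fun p : History N M t × ((Fin N × Fin M) × ℝ) =>
      (Fin.snoc (α := fun _ => (Fin N × Fin M) × ℝ) p.1 p.2 : History N M (t + 1)) := by
  refine measurable_pi_iff.2 fun i => ?_
  refine Fin.lastCases ?_ (fun j => ?_) i
  · simpa using measurable_snd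
  · simp only [Fin.snoc_castSucc]; fun_prop

lemma measurable_apply_arm :
    Measurable fun p : (Fin N × Fin M → ℝ) × (Fin N × Fin M) => p.1 p.2 :=
  measurable_from_prod_countable_left fun a => measurable_pi_apply a

lemma measurable_view (t : ℕ) : Measurable (π.view t) := by
  refine measurable_fst.prodMk ?_
  induction t with
  | zero => exact measurable_const
  | succ t ih =>
    have ha : Measurable fun ω : π.Outcome => π.action t ω :=
      (π.measurable_sample t).comp (measurable_fst.prodMk ih)
    have hy : Measurable fun ω : π.Outcome => ω.2 t := (measurable_pi_apply t).comp measurable_snd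
    exact (measurable_snoc t).comp
      (ih.prodMk (ha.prodMk (measurable_apply_arm.comp (hy.prodMk ha))))

lemma view_update (t : ℕ) (ω : π.Outcome) {s : ℕ} (h : s ≤ t) (y : Fin N × Fin M → ℝ) :
    π.view s (ω.1, Function.update ω.2 t y) = π.view s ω := by
  unfold view
  congr 1
  induction s with
  | zero => rfl
  | succ s ih =>
    have hs := ih (by omega)
    have : s ≠ t := by omega
    rw [history_succ, history_succ, hs]
    simp only [obs, action, view, hs, Function.update_of_ne this]

/-- The law of the rewards of one round. -/
def tableLaw (ν : Env N M) : Measure (Fin N × Fin M → ℝ) :=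
  Measure.pi fun p : Fin N × Fin M => (ν p.1 p.2 : Measure ℝ)

instance (ν : Env N M) : IsProbabilityMeasure (tableLaw ν) := by
  unfold tableLaw; infer_instance

/-- The rewards of round `t` are independent of what is known before it. -/
lemma map_view_table (ν : Env N M) (t : ℕ) :
    (π.law ν).map (fun ω => (π.view t ω, ω.2 t)) =
      ((π.law ν).map (π.view t)).prod (tableLaw ν) := by
  have hy : Measurable fun ω : π.Outcome => ω.2 t := (measurable_pi_apply t).comp measurable_snd
  have hu : Measurable fun p : π.Outcome × (Fin N × Fin M → ℝ) =>
      ((p.1.1, Function.update p.1.2 t p.2) : π.Outcome) :=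
    (measurable_fst.comp measurable_fst).prodMk
      ((measurable_update_prod t).comp ((measurable_snd.comp measurable_fst).prodMk measurable_snd))
  have key : ((π.law ν).prod (tableLaw ν)).map
      (fun p => ((p.1.1, Function.update p.1.2 t p.2) : π.Outcome)) = π.law ν := by
    have h1 : (π.law ν).prod (tableLaw ν) =
        (((π.seedLaw : Measure π.Seed).prod ((Measure.infinitePi fun _ : ℕ => tableLaw ν).prod
          (tableLaw ν)))).map MeasurableEquiv.prodAssoc.symm := by
      rw [← Measure.prodAssoc_prod]
      rw [Measure.map_map (MeasurableEquiv.measurable _) (MeasurableEquiv.measurable _)]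
      simp [law, tableLaw]
    rw [h1, Measure.map_map hu (MeasurableEquiv.measurable _)]
    have h2 : (fun p : π.Outcome × (Fin N × Fin M → ℝ) =>
        ((p.1.1, Function.update p.1.2 t p.2) : π.Outcome)) ∘ MeasurableEquiv.prodAssoc.symm =
        Prod.map id (fun p => Function.update p.1 t p.2) := rfl
    rw [h2, ← Measure.map_prod_map _ _ measurable_id (measurable_update_prod t),
      infinitePi_prod_map_update (fun _ => tableLaw ν) t, Measure.map_id]
    rfl
  conv_lhs => rw [← key]
  rw [Measure.map_map ((π.measurable_view t).prodMk hy) hu]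
  have : (fun ω : π.Outcome => (π.view t ω, ω.2 t)) ∘
      (fun p : π.Outcome × (Fin N × Fin M → ℝ) =>
        ((p.1.1, Function.update p.1.2 t p.2) : π.Outcome)) = Prod.map (π.view t) id := by
    funext p
    simp [π.view_update t p.1 le_rfl p.2, Prod.map]
  rw [this, ← Measure.map_prod_map _ _ (π.measurable_view t) measurable_id, Measure.map_id]

end Policy
/-- A positive function `ℓ` with bounded logarithm that is a lower bound for the likelihood ratio
of `p'` with respect to `p`, and with which the Kullback-Leibler divergence of `p` from `p'` is
seen to be at most `K`. -/
structure IsLikelihoodBound (p p' : ProbabilityMeasure ℝ) (ℓ : ℝ → ℝ) (K : ℝ) : Prop where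
  measurable : Measurable ℓ
  pos : ∀ x, 0 < ℓ x
  bounded : ∃ B, ∀ x, |Real.log (ℓ x)| ≤ B
  withDensity_le : (p : Measure ℝ).withDensity (fun x => ENNReal.ofReal (ℓ x)) ≤ p'
  nonneg : 0 ≤ K
  integral_le : ∫ x, -Real.log (ℓ x) ∂(p : Measure ℝ) ≤ K

lemma integral_nonpos_of_lintegral_exp_le_one {Ω : Type*} [MeasurableSpace Ω] {P : Measure Ω}
    [IsProbabilityMeasure P] {X : Ω → ℝ} (hX : Integrable X P)
    (h : ∫⁻ ω, ENNReal.ofReal (Real.exp (X ω)) ∂P ≤ 1) : ∫ ω, X ω ∂P ≤ 0 := by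
  have hm : AEStronglyMeasurable (fun ω => Real.exp (X ω)) P :=
    Real.continuous_exp.comp_aestronglyMeasurable hX.1
  have hn : 0 ≤ᵐ[P] fun ω => Real.exp (X ω) := ae_of_all _ fun ω => (Real.exp_pos _).le
  have hexp : Integrable (fun ω => Real.exp (X ω)) P :=
    (lintegral_ofReal_ne_top_iff_integrable hm hn).1 (ne_top_of_le_ne_top ENNReal.one_ne_top h)
  have h1 : ∫ ω, Real.exp (X ω) ∂P ≤ 1 := by
    rw [integral_eq_lintegral_of_nonneg_ae hn hm]
    exact ENNReal.toReal_le_of_le_ofReal zero_le_one (by simpa using h)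
  calc ∫ ω, X ω ∂P ≤ ∫ ω, (Real.exp (X ω) - 1) ∂P :=
        integral_mono hX (hexp.sub (integrable_const _)) fun ω => by
          linarith [Real.add_one_le_exp (X ω)]
    _ = ∫ ω, Real.exp (X ω) ∂P - 1 := by rw [integral_sub hexp (integrable_const _)]; simp
    _ ≤ 0 := by linarith

namespace Policy

variable {N M : ℕ} (π : Policy N M)

/-- What the policy knows after a round in which it has received the reward `x`. -/
def extend (t : ℕ) (p : π.Seed × History N M t) (x : ℝ) : π.Seed × History N M (t + 1) :=
  (p.1, Fin.snoc (α := fun _ => (Fin N × Fin M) × ℝ) p.2 (π.sample t p, x))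

lemma measurable_extend (t : ℕ) :
    Measurable fun q : (π.Seed × History N M t) × ℝ => π.extend t q.1 q.2 :=
  (measurable_fst.comp measurable_fst).prodMk ((measurable_snoc t).comp
    ((measurable_snd.comp measurable_fst).prodMk
      (((π.measurable_sample t).comp measurable_fst).prodMk measurable_snd)))

lemma measurable_extend_apply (t : ℕ) :
    Measurable fun q : (π.Seed × History N M t) × (Fin N × Fin M → ℝ) =>
      π.extend t q.1 (q.2 (π.sample t q.1)) :=
  (π.measurable_extend t).comp (measurable_fst.prodMk
    (measurable_apply_arm.comp
      (measurable_snd.prodMk ((π.measurable_sample t).comp measurable_fst))))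

lemma lintegral_tableLaw (ν : Env N M) (a : Fin N × Fin M) {f : ℝ → ENNReal} (hf : Measurable f) :
    ∫⁻ y, f (y a) ∂(tableLaw ν) = ∫⁻ x, f x ∂(ν a.1 a.2 : Measure ℝ) :=
  (measurePreserving_eval (fun p : Fin N × Fin M => (ν p.1 p.2 : Measure ℝ)) a).lintegral_comp hf

/-- The conditional expectation of a function of what is known after round `t`. -/
def expectNext (ν : Env N M) (t : ℕ) (g : π.Seed × History N M (t + 1) → ENNReal)
    (p : π.Seed × History N M t) : ENNReal :=
  ∫⁻ x, g (π.extend t p x) ∂(ν (π.sample t p).1 (π.sample t p).2 : Measure ℝ)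

lemma expectNext_eq (ν : Env N M) (t : ℕ) {g : π.Seed × History N M (t + 1) → ENNReal}
    (hg : Measurable g) (p : π.Seed × History N M t) :
    π.expectNext ν t g p = ∫⁻ y, g (π.extend t p (y (π.sample t p))) ∂(tableLaw ν) :=
  (lintegral_tableLaw ν (π.sample t p) (f := fun x => g (π.extend t p x))
    (hg.comp ((π.measurable_extend t).comp (measurable_const.prodMk measurable_id)))).symm

lemma measurable_expectNext (ν : Env N M) (t : ℕ) {g : π.Seed × History N M (t + 1) → ENNReal}
    (hg : Measurable g) : Measurable (π.expectNext ν t g) := by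
  have : π.expectNext ν t g =
      fun p => ∫⁻ y, g (π.extend t p (y (π.sample t p))) ∂(tableLaw ν) :=
    funext (π.expectNext_eq ν t hg)
  rw [this]
  exact (hg.comp (π.measurable_extend_apply t)).lintegral_prod_right'

lemma lintegral_view_succ (ν : Env N M) (t : ℕ) {g : π.Seed × History N M (t + 1) → ENNReal}
    (hg : Measurable g) :
    ∫⁻ ω, g (π.view (t + 1) ω) ∂(π.law ν) = ∫⁻ ω, π.expectNext ν t g (π.view t ω) ∂(π.law ν) := by
  have hy : Measurable fun ω : π.Outcome => ω.2 t := (measurable_pi_apply t).comp measurable_snd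
  have hG : Measurable fun q : (π.Seed × History N M t) × (Fin N × Fin M → ℝ) =>
      g (π.extend t q.1 (q.2 (π.sample t q.1))) := hg.comp (π.measurable_extend_apply t)
  have h1 : ∫⁻ ω, g (π.view (t + 1) ω) ∂(π.law ν) =
      ∫⁻ q, g (π.extend t q.1 (q.2 (π.sample t q.1)))
        ∂((π.law ν).map (fun ω => (π.view t ω, ω.2 t))) := by
    rw [lintegral_map hG ((π.measurable_view t).prodMk hy)]
    rfl
  rw [h1, map_view_table, lintegral_prod _ hG.aemeasurable,
    ← lintegral_map (π.measurable_expectNext ν t hg) (π.measurable_view t)]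
  exact lintegral_congr fun p => (π.expectNext_eq ν t hg p).symm

/-- The likelihood bound along a history. -/
def weight (ℓ : Fin N × Fin M → ℝ → ℝ) (k : ℕ) (p : π.Seed × History N M k) : ENNReal :=
  ∏ i, ENNReal.ofReal (ℓ (p.2 i).1 (p.2 i).2)

variable {ν ν' : Env N M} {ℓ : Fin N × Fin M → ℝ → ℝ} {K : Fin N × Fin M → ℝ}

lemma measurable_uncurry_arm (hℓ : ∀ a, Measurable (ℓ a)) :
    Measurable fun q : (Fin N × Fin M) × ℝ => ℓ q.1 q.2 :=
  measurable_from_prod_countable_right hℓ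

lemma measurable_weight (hℓ : ∀ a, Measurable (ℓ a)) (k : ℕ) : Measurable (π.weight ℓ k) := by
  refine Finset.measurable_prod _ fun i _ => ENNReal.measurable_ofReal.comp ?_
  exact (measurable_uncurry_arm hℓ).comp ((measurable_pi_apply i).comp measurable_snd)

lemma weight_extend (k : ℕ) (p : π.Seed × History N M k) (x : ℝ) :
    π.weight ℓ (k + 1) (π.extend k p x) =
      π.weight ℓ k p * ENNReal.ofReal (ℓ (π.sample k p) x) := by
  simp [weight, extend, Fin.prod_univ_castSucc]

lemma lintegral_mul_weight_le
    (h : ∀ a : Fin N × Fin M, IsLikelihoodBound (ν a.1 a.2) (ν' a.1 a.2) (ℓ a) (K a)) (k : ℕ)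
    {g : π.Seed × History N M k → ENNReal} (hg : Measurable g) :
    ∫⁻ ω, g (π.view k ω) * π.weight ℓ k (π.view k ω) ∂(π.law ν) ≤
      ∫⁻ ω, g (π.view k ω) ∂(π.law ν') := by
  have hℓ : ∀ a, Measurable (ℓ a) := fun a => (h a).measurable
  induction k with
  | zero =>
    have h0 : ∀ ω : π.Outcome, π.view 0 ω = (ω.1, Fin.elim0) := fun ω => rfl
    simp only [h0, weight, Finset.univ_eq_empty, Finset.prod_empty, mul_one]
    have hg' : Measurable fun s : π.Seed => g (s, Fin.elim0) :=
      hg.comp (measurable_id.prodMk measurable_const)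
    have : ∀ ν : Env N M, ∫⁻ ω : π.Outcome, g (ω.1, Fin.elim0) ∂(π.law ν) =
        ∫⁻ s, g (s, Fin.elim0) ∂(π.seedLaw : Measure π.Seed) := fun ν => by
      have hg'' : Measurable fun ω : π.Outcome => g (ω.1, Fin.elim0) := hg'.comp measurable_fst
      rw [law, lintegral_prod _ hg''.aemeasurable]
      simp
    rw [this, this]
  | succ k ih =>
    rw [π.lintegral_view_succ ν k (g := fun p => g p * π.weight ℓ (k + 1) p)
      (hg.mul (π.measurable_weight hℓ _)), π.lintegral_view_succ ν' k hg]
    refine le_trans (lintegral_mono fun ω => ?_) (ih (π.measurable_expectNext ν' k hg))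
    generalize π.view k ω = p
    have hgp : Measurable fun x => g (π.extend k p x) :=
      hg.comp ((π.measurable_extend k).comp (measurable_const.prodMk measurable_id))
    have hp := h (π.sample k p)
    have hℓp : Measurable fun x => ENNReal.ofReal (ℓ (π.sample k p) x) :=
      ENNReal.measurable_ofReal.comp (hℓ _)
    have hm : Measurable fun x => ENNReal.ofReal (ℓ (π.sample k p) x) * g (π.extend k p x) :=
      hℓp.mul hgp
    calc π.expectNext ν k (fun p => g p * π.weight ℓ (k + 1) p) p
        = π.weight ℓ k p * ∫⁻ x, ENNReal.ofReal (ℓ (π.sample k p) x) * g (π.extend k p x)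
            ∂(ν (π.sample k p).1 (π.sample k p).2 : Measure ℝ) := by
          rw [← lintegral_const_mul _ hm]
          refine lintegral_congr fun x => ?_
          beta_reduce
          rw [weight_extend]; ring
      _ = π.weight ℓ k p * ∫⁻ x, g (π.extend k p x)
            ∂((ν (π.sample k p).1 (π.sample k p).2 : Measure ℝ).withDensity
              fun x => ENNReal.ofReal (ℓ (π.sample k p) x)) := by
          rw [lintegral_withDensity_eq_lintegral_mul _ hℓp hgp]
          rfl
      _ ≤ π.weight ℓ k p * π.expectNext ν' k g p := by
          gcongr
          exact lintegral_mono' hp.withDensity_le le_rfl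
      _ = _ := mul_comm _ _

/-- The set of what may be known after `k` rounds if the policy has not stopped before. -/
def alive (k : ℕ) : Set (π.Seed × History N M k) :=
  {p | ∀ j (h : j < k), (p.1, fun i : Fin j => p.2 (Fin.castLE h.le i)) ∉ π.halt j}

lemma measurableSet_alive (k : ℕ) : MeasurableSet (π.alive k) := by
  have : π.alive k = ⋂ j, ⋂ h : j < k,
      ((fun p : π.Seed × History N M k => (p.1, fun i : Fin j => p.2 (Fin.castLE h.le i))) ⁻¹'
        π.halt j)ᶜ := by
    ext p; simp [alive]
  rw [this]
  refine MeasurableSet.iInter fun j => MeasurableSet.iInter fun h => MeasurableSet.compl ?_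
  exact (measurable_fst.prodMk (measurable_pi_iff.2 fun i =>
    (measurable_pi_apply _).comp measurable_snd)) (π.measurableSet_halt j)

lemma view_mem_alive_iff {k : ℕ} {ω : π.Outcome} :
    π.view k ω ∈ π.alive k ↔ ∀ j < k, π.view j ω ∉ π.halt j := by
  have : ∀ j (h : j < k), ((π.view k ω).1, fun i : Fin j => (π.view k ω).2 (Fin.castLE h.le i)) =
      π.view j ω := fun j h => by
    refine Prod.ext rfl (funext fun i => ?_)
    simp [view, history_apply]
  exact forall₂_congr fun j h => by rw [this j h]

lemma le_stopTime_iff {k : ℕ} {ω : π.Outcome} :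
    (k : ℕ∞) ≤ π.stopTime ω ↔ π.view k ω ∈ π.alive k := by
  rw [view_mem_alive_iff]
  simp only [stopTime, le_iInf_iff, Nat.cast_le]
  exact ⟨fun h j hj hm => absurd (h j hm) (by omega), fun h j hm => by
    by_contra hc; exact h j (by omega) hm⟩

lemma lt_stopTime_iff {k : ℕ} {ω : π.Outcome} :
    (k : ℕ∞) < π.stopTime ω ↔ π.view k ω ∈ π.alive k \ π.halt k := by
  have h1 : (k : ℕ∞) < π.stopTime ω ↔ ((k + 1 : ℕ) : ℕ∞) ≤ π.stopTime ω := by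
    rw [Nat.cast_add, Nat.cast_one, ENat.add_one_le_iff (ENat.natCast_ne_top k)]
  rw [h1, le_stopTime_iff, view_mem_alive_iff, Set.mem_sdiff, view_mem_alive_iff]
  exact ⟨fun h => ⟨fun j hj => h j (by omega), h k (by omega)⟩, fun h j hj => by
    rcases Nat.lt_succ_iff_lt_or_eq.1 hj with h' | rfl
    exacts [h.1 j h', h.2]⟩

lemma stopTime_eq_iff {k : ℕ} {ω : π.Outcome} :
    π.stopTime ω = k ↔ π.view k ω ∈ π.alive k ∩ π.halt k := by
  have := π.le_stopTime_iff (k := k) (ω := ω)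
  have := π.lt_stopTime_iff (k := k) (ω := ω)
  rw [le_antisymm_iff, ← not_lt]
  simp only [Set.mem_inter_iff, Set.mem_sdiff] at *
  tauto

/-- The event that the pair `a` is sampled in round `t`. -/
def samplesAt (t : ℕ) (a : Fin N × Fin M) : Set π.Outcome :=
  {ω | (t : ℕ∞) < π.stopTime ω ∧ π.action t ω = a}

lemma samplesAt_eq (t : ℕ) (a : Fin N × Fin M) :
    π.samplesAt t a = π.view t ⁻¹' ((π.alive t \ π.halt t) ∩ π.sample t ⁻¹' {a}) := by
  ext ω
  simp only [samplesAt, Set.mem_ofPred_eq, lt_stopTime_iff]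
  rfl

lemma measurableSet_sampling_info (t : ℕ) (a : Fin N × Fin M) :
    MeasurableSet ((π.alive t \ π.halt t) ∩ π.sample t ⁻¹' {a}) :=
  ((π.measurableSet_alive t).diff (π.measurableSet_halt t)).inter
    (π.measurable_sample t (measurableSet_singleton a))

lemma measurableSet_samplesAt (t : ℕ) (a : Fin N × Fin M) : MeasurableSet (π.samplesAt t a) := by
  rw [samplesAt_eq]
  exact π.measurable_view t (π.measurableSet_sampling_info t a)

/-- The expected number of samples of the pair `a`. -/
def samplesOf (ν : Env N M) (a : Fin N × Fin M) : ENNReal := ∑' t, π.law ν (π.samplesAt t a)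

lemma sum_samplesOf_le (ν : Env N M) : ∑ a, π.samplesOf ν a ≤ π.expectedSamples ν := by
  have h1 : ∑ a, π.samplesOf ν a =
      ∫⁻ ω, ∑ a, ∑' t, (π.samplesAt t a).indicator 1 ω ∂(π.law ν) := by
    rw [lintegral_finsetSum _ fun a _ => Measurable.tsum fun t =>
      measurable_one.indicator (π.measurableSet_samplesAt t a)]
    refine Finset.sum_congr rfl fun a _ => ?_
    rw [lintegral_tsum fun t =>
      (measurable_one.indicator (π.measurableSet_samplesAt t a)).aemeasurable]
    exact tsum_congr fun t => (lintegral_indicator_one (π.measurableSet_samplesAt t a)).symm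
  rw [h1]
  refine lintegral_mono fun ω => ?_
  have h2 : ∀ t : ℕ, ∑ a, (π.samplesAt t a).indicator (1 : π.Outcome → ENNReal) ω =
      if (t : ℕ∞) < π.stopTime ω then 1 else 0 := fun t => by
    rw [Finset.sum_eq_single (π.action t ω)]
    · simp [samplesAt, Set.indicator_apply]
    · intro b _ hb
      exact Set.indicator_of_notMem (fun h => hb h.2.symm) _
    · simp
  rw [← Summable.tsum_finsetSum fun _ _ => ENNReal.summable]
  simp only [h2]
  by_cases hτ : π.stopTime ω = ⊤
  · simp [hτ]
  · obtain ⟨n, hn⟩ := ENat.ne_top_iff_exists.1 hτ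
    rw [← hn, tsum_eq_sum (s := Finset.range n) fun t ht => by
      simpa using ht]
    simp only [Nat.cast_lt]
    rw [Finset.sum_congr rfl fun t ht => if_pos (Finset.mem_range.1 ht)]
    simp

/-- The round in which the policy stops, or `n` if it has not stopped before. -/
def stopIdx (n : ℕ) (ω : π.Outcome) : ℕ := (min (π.stopTime ω) n).toNat

lemma coe_stopIdx (n : ℕ) (ω : π.Outcome) : (π.stopIdx n ω : ℕ∞) = min (π.stopTime ω) n :=
  ENat.natCast_toNat (ne_top_of_le_ne_top (ENat.natCast_ne_top n) (min_le_right _ _))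

lemma stopIdx_le (n : ℕ) (ω : π.Outcome) : π.stopIdx n ω ≤ n := by
  have := π.coe_stopIdx n ω
  exact_mod_cast this.trans_le (min_le_right _ _)

lemma lt_stopIdx_iff {n t : ℕ} {ω : π.Outcome} :
    t < π.stopIdx n ω ↔ t < n ∧ (t : ℕ∞) < π.stopTime ω := by
  rw [← Nat.cast_lt (α := ℕ∞), coe_stopIdx, lt_min_iff, Nat.cast_lt, and_comm]

lemma stopIdx_lt_iff {n j : ℕ} (hj : j < n) {ω : π.Outcome} :
    π.stopIdx n ω = j ↔ π.stopTime ω = j := by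
  rw [← Nat.cast_inj (R := ℕ∞), coe_stopIdx]
  constructor
  · intro h
    rcases min_choice (π.stopTime ω) (n : ℕ∞) with h' | h'
    · rw [← h, h']
    · rw [h] at h'; exact absurd (Nat.cast_inj.1 h') hj.ne
  · intro h
    rw [h]; exact min_eq_left (by exact_mod_cast hj.le)

lemma measurableSet_stopIdx_info (n j : ℕ) :
    ∃ E : Set (π.Seed × History N M j), MeasurableSet E ∧
      ∀ ω, π.stopIdx n ω = j ↔ π.view j ω ∈ E := by
  rcases lt_trichotomy j n with h | rfl | h
  · exact ⟨_, (π.measurableSet_alive j).inter (π.measurableSet_halt j), fun ω => by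
      rw [π.stopIdx_lt_iff h, stopTime_eq_iff]⟩
  · refine ⟨_, π.measurableSet_alive j, fun ω => ?_⟩
    rw [← le_stopTime_iff, ← Nat.cast_inj (R := ℕ∞), coe_stopIdx, min_eq_right_iff]
  · exact ⟨∅, MeasurableSet.empty, fun ω => by
      simpa using ((π.stopIdx_le n ω).trans_lt h).ne⟩

/-- Change of measure up to a bounded stopping time. -/
lemma lintegral_stopIdx_mul_weight_le
    (h : ∀ a : Fin N × Fin M, IsLikelihoodBound (ν a.1 a.2) (ν' a.1 a.2) (ℓ a) (K a)) (n : ℕ)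
    {g : ∀ j, π.Seed × History N M j → ENNReal} (hg : ∀ j, Measurable (g j)) :
    ∫⁻ ω, g (π.stopIdx n ω) (π.view _ ω) * π.weight ℓ _ (π.view (π.stopIdx n ω) ω) ∂(π.law ν) ≤
      ∫⁻ ω, g (π.stopIdx n ω) (π.view _ ω) ∂(π.law ν') := by
  choose E hE hEiff using fun j => π.measurableSet_stopIdx_info n j
  have hℓ : ∀ a, Measurable (ℓ a) := fun a => (h a).measurable
  have hsplit : ∀ (ν : Env N M) (f : ∀ j, π.Seed × History N M j → ENNReal),
      (∀ j, Measurable (f j)) → ∫⁻ ω, f (π.stopIdx n ω) (π.view _ ω) ∂(π.law ν) =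
        ∑ j ∈ Finset.range (n + 1), ∫⁻ ω, (E j).indicator (f j) (π.view j ω) ∂(π.law ν) := by
    intro ν f hf
    have hm : ∀ j, Measurable fun ω => (E j).indicator (f j) (π.view j ω) := fun j =>
      ((hf j).indicator (hE j)).comp (π.measurable_view j)
    rw [← lintegral_finsetSum _ fun j _ => hm j]
    refine lintegral_congr fun ω => ?_
    rw [Finset.sum_eq_single (π.stopIdx n ω)]
    · exact (Set.indicator_of_mem ((hEiff _ ω).1 rfl) _).symm
    · intro j _ hj
      exact Set.indicator_of_notMem (fun hm => hj ((hEiff j ω).2 hm).symm) _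
    · intro hn
      exact absurd (Finset.mem_range.2 (Nat.lt_succ_of_le (π.stopIdx_le n ω))) hn
  rw [hsplit ν (fun j p => g j p * π.weight ℓ j p)
    fun j => (hg j).mul (π.measurable_weight hℓ j), hsplit ν' g hg]
  refine Finset.sum_le_sum fun j _ => ?_
  refine le_trans (le_of_eq (lintegral_congr fun ω => ?_))
    (π.lintegral_mul_weight_le h j ((hg j).indicator (hE j)))
  by_cases hm : π.view j ω ∈ E j <;> simp [hm]

/-- The event that the policy stops before round `n` and outputs `o`. -/
def outputsBefore (o : Option (Fin N)) (n : ℕ) : Set π.Outcome :=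
  {ω | ∃ t < n, π.stopTime ω = t ∧ π.output t (π.view t ω) = o}

lemma measurableSet_outputsBefore (o : Option (Fin N)) (n : ℕ) :
    MeasurableSet (π.outputsBefore o n) := by
  have : π.outputsBefore o n = ⋃ t, ⋃ _ : t < n,
      π.view t ⁻¹' ((π.alive t ∩ π.halt t) ∩ π.output t ⁻¹' {o}) := by
    ext ω
    simp only [outputsBefore, stopTime_eq_iff, Set.mem_iUnion, exists_prop]
    rfl
  rw [this]
  exact MeasurableSet.iUnion fun t => MeasurableSet.iUnion fun _ => π.measurable_view t
    (((π.measurableSet_alive t).inter (π.measurableSet_halt t)).inter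
      (π.measurableSet_output t o))

lemma mem_outputsBefore_iff {o : Option (Fin N)} {n : ℕ} {ω : π.Outcome} :
    ω ∈ π.outputsBefore o n ↔
      π.stopIdx n ω < n ∧ π.output (π.stopIdx n ω) (π.view (π.stopIdx n ω) ω) = o := by
  constructor
  · rintro ⟨t, ht, h1, h2⟩
    obtain rfl := (π.stopIdx_lt_iff ht).2 h1
    exact ⟨ht, h2⟩
  · rintro ⟨h1, h2⟩
    exact ⟨_, h1, (π.stopIdx_lt_iff h1).1 rfl, h2⟩

lemma iUnion_outputsBefore (o : Option (Fin N)) : ⋃ n, π.outputsBefore o n = π.outputs o := by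
  ext ω
  simp only [Set.mem_iUnion, outputsBefore, outputs, Set.mem_ofPred_eq]
  exact ⟨fun ⟨n, t, _, h⟩ => ⟨t, h⟩, fun ⟨t, h⟩ => ⟨t + 1, t, Nat.lt_succ_self t, h⟩⟩

lemma monotone_outputsBefore (o : Option (Fin N)) : Monotone (π.outputsBefore o) :=
  fun _ _ hmn _ ⟨t, ht, h⟩ => ⟨t, ht.trans_le hmn, h⟩

lemma measurableSet_outputs (o : Option (Fin N)) : MeasurableSet (π.outputs o) := by
  rw [← iUnion_outputsBefore]
  exact MeasurableSet.iUnion fun n => π.measurableSet_outputsBefore o n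

lemma disjoint_outputs {o o' : Option (Fin N)} (h : o ≠ o') :
    Disjoint (π.outputs o) (π.outputs o') := by
  refine Set.disjoint_left.2 ?_
  rintro ω ⟨t, ht, ho⟩ ⟨s, hs, hos⟩
  obtain rfl : t = s := by exact_mod_cast ht.symm.trans hs
  exact h (ho.symm.trans hos)

/-- The logarithm of the likelihood ratio after `n` rounds, or when the policy stops. -/
def logLik (ℓ : Fin N × Fin M → ℝ → ℝ) (n : ℕ) (ω : π.Outcome) : ℝ :=
  ∑ t ∈ Finset.range n, ∑ a, (π.samplesAt t a).indicator (fun ω => -Real.log (ℓ a (ω.2 t a))) ω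

lemma logLik_eq (n : ℕ) (ω : π.Outcome) :
    π.logLik ℓ n ω =
      ∑ t ∈ Finset.range (π.stopIdx n ω), -Real.log (ℓ (π.obs t ω).1 (π.obs t ω).2) := by
  have h1 : ∀ t, ∑ a, (π.samplesAt t a).indicator (fun ω => -Real.log (ℓ a (ω.2 t a))) ω =
      if (t : ℕ∞) < π.stopTime ω then -Real.log (ℓ (π.obs t ω).1 (π.obs t ω).2) else 0 := by
    intro t
    rw [Finset.sum_eq_single (π.action t ω)]
    · simp [samplesAt, Set.indicator_apply, obs]
    · intro b _ hb
      exact Set.indicator_of_notMem (fun h => hb h.2.symm) _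
    · simp
  simp only [logLik, h1]
  rw [← Finset.sum_filter]
  refine Finset.sum_congr ?_ fun _ _ => rfl
  ext t
  simp [lt_stopIdx_iff]

lemma weight_stopIdx (hℓ : ∀ a x, 0 < ℓ a x) (n : ℕ) (ω : π.Outcome) :
    π.weight ℓ _ (π.view (π.stopIdx n ω) ω) = ENNReal.ofReal (Real.exp (-π.logLik ℓ n ω)) := by
  rw [logLik_eq, ← Finset.sum_neg_distrib, Real.exp_sum,
    ENNReal.ofReal_prod_of_nonneg fun _ _ => (Real.exp_pos _).le, weight,
    ← Fin.prod_univ_eq_prod_range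
      (fun t => ENNReal.ofReal (Real.exp (- -Real.log (ℓ (π.obs t ω).1 (π.obs t ω).2))))]
  refine Finset.prod_congr rfl fun i _ => ?_
  rw [neg_neg, Real.exp_log (hℓ _ _)]
  simp only [view, history_apply]

lemma integral_samplesAt (ν : Env N M) (t : ℕ) (a : Fin N × Fin M) {k : ℝ → ℝ} (hk : Measurable k) :
    ∫ ω, (π.samplesAt t a).indicator (fun ω => k (ω.2 t a)) ω ∂(π.law ν) =
      (π.law ν).real (π.samplesAt t a) * ∫ x, k x ∂(ν a.1 a.2 : Measure ℝ) := by
  have hy : Measurable fun ω : π.Outcome => ω.2 t := (measurable_pi_apply t).comp measurable_snd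
  set E := (π.alive t \ π.halt t) ∩ π.sample t ⁻¹' {a} with hEdef
  have hE : MeasurableSet E := π.measurableSet_sampling_info t a
  have hf : Measurable (E.indicator (1 : π.Seed × History N M t → ℝ)) := measurable_one.indicator hE
  have hg : Measurable fun y : Fin N × Fin M → ℝ => k (y a) := hk.comp (measurable_pi_apply a)
  have hfg : Measurable fun q : (π.Seed × History N M t) × (Fin N × Fin M → ℝ) =>
      E.indicator (1 : π.Seed × History N M t → ℝ) q.1 * k (q.2 a) :=
    (hf.comp measurable_fst).mul (hg.comp measurable_snd)
  have h1 : ∫ ω, (π.samplesAt t a).indicator (fun ω => k (ω.2 t a)) ω ∂(π.law ν) =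
      ∫ q, E.indicator (1 : π.Seed × History N M t → ℝ) q.1 * k (q.2 a)
        ∂((π.law ν).map (fun ω => (π.view t ω, ω.2 t))) := by
    rw [integral_map ((π.measurable_view t).prodMk hy).aemeasurable hfg.aestronglyMeasurable]
    refine integral_congr_ae (ae_of_all _ fun ω => ?_)
    simp only [samplesAt_eq, ← hEdef]
    by_cases hm : π.view t ω ∈ E <;> simp [hm]
  have h2 : ∫ p, E.indicator (1 : π.Seed × History N M t → ℝ) p ∂((π.law ν).map (π.view t)) =
      (π.law ν).real (π.samplesAt t a) := by
    rw [integral_indicator_one hE, map_measureReal_apply (π.measurable_view t) hE, ← samplesAt_eq]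
  have h3 : ∫ y, k (y a) ∂(tableLaw ν) = ∫ x, k x ∂(ν a.1 a.2 : Measure ℝ) := by
    have hmp := measurePreserving_eval (fun p : Fin N × Fin M => (ν p.1 p.2 : Measure ℝ)) a
    rw [← hmp.map_eq, integral_map (measurable_pi_apply a).aemeasurable hk.aestronglyMeasurable]
    rfl
  rw [h1, map_view_table, integral_prod_mul (E.indicator (1 : π.Seed × History N M t → ℝ))
    (fun y : Fin N × Fin M → ℝ => k (y a)), h2, h3]

lemma integrable_samplesAt
    (h : ∀ a : Fin N × Fin M, IsLikelihoodBound (ν a.1 a.2) (ν' a.1 a.2) (ℓ a) (K a)) (t : ℕ)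
    (a : Fin N × Fin M) :
    Integrable ((π.samplesAt t a).indicator fun ω => -Real.log (ℓ a (ω.2 t a))) (π.law ν) := by
  obtain ⟨B, hB⟩ := (h a).bounded
  have hm : Measurable fun ω : π.Outcome => -Real.log (ℓ a (ω.2 t a)) :=
    (Real.measurable_log.comp ((h a).measurable.comp
      ((measurable_pi_apply a).comp ((measurable_pi_apply t).comp measurable_snd)))).neg
  refine Integrable.indicator ?_ (π.measurableSet_samplesAt t a)
  exact Integrable.of_bound hm.aestronglyMeasurable B (ae_of_all _ fun ω => by
    simpa using hB (ω.2 t a))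

lemma integrable_logLik
    (h : ∀ a : Fin N × Fin M, IsLikelihoodBound (ν a.1 a.2) (ν' a.1 a.2) (ℓ a) (K a)) (n : ℕ) :
    Integrable (π.logLik ℓ n) (π.law ν) :=
  integrable_finsetSum _ fun t _ => integrable_finsetSum _ fun a _ => π.integrable_samplesAt h t a

lemma samplesOf_ne_top (hfin : π.expectedSamples ν ≠ ⊤) (a : Fin N × Fin M) :
    π.samplesOf ν a ≠ ⊤ :=
  ne_top_of_le_ne_top hfin ((Finset.single_le_sum (fun _ _ => zero_le) (Finset.mem_univ a)).trans
    (π.sum_samplesOf_le ν))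

lemma integral_logLik_le
    (h : ∀ a : Fin N × Fin M, IsLikelihoodBound (ν a.1 a.2) (ν' a.1 a.2) (ℓ a) (K a))
    (hfin : π.expectedSamples ν ≠ ⊤) (n : ℕ) :
    ∫ ω, π.logLik ℓ n ω ∂(π.law ν) ≤ ∑ a, (π.samplesOf ν a).toReal * K a := by
  have h1 : ∫ ω, π.logLik ℓ n ω ∂(π.law ν) = ∑ t ∈ Finset.range n, ∑ a,
      (π.law ν).real (π.samplesAt t a) * ∫ x, -Real.log (ℓ a x) ∂(ν a.1 a.2 : Measure ℝ) := by
    unfold logLik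
    rw [integral_finsetSum _ fun t _ => integrable_finsetSum _ fun a _ =>
      π.integrable_samplesAt h t a]
    refine Finset.sum_congr rfl fun t _ => ?_
    rw [integral_finsetSum _ fun a _ => π.integrable_samplesAt h t a]
    exact Finset.sum_congr rfl fun a _ =>
      π.integral_samplesAt ν t a (Real.measurable_log.comp (h a).measurable).neg
  rw [h1, Finset.sum_comm]
  refine Finset.sum_le_sum fun a _ => ?_
  rw [← Finset.sum_mul]
  have h2 : ∑ t ∈ Finset.range n, (π.law ν).real (π.samplesAt t a) ≤ (π.samplesOf ν a).toReal := by
    simp only [Measure.real]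
    rw [← ENNReal.toReal_sum fun t _ => measure_ne_top _ _]
    exact ENNReal.toReal_mono (π.samplesOf_ne_top hfin a) (ENNReal.sum_le_tsum _)
  calc _ ≤ (∑ t ∈ Finset.range n, (π.law ν).real (π.samplesAt t a)) * K a :=
        mul_le_mul_of_nonneg_left (h a).integral_le (Finset.sum_nonneg fun _ _ => by positivity)
    _ ≤ _ := mul_le_mul_of_nonneg_right h2 (h a).nonneg

lemma log_odds_mul_le_of_outputsBefore
    (h : ∀ a : Fin N × Fin M, IsLikelihoodBound (ν a.1 a.2) (ν' a.1 a.2) (ℓ a) (K a))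
    (hfin : π.expectedSamples ν ≠ ⊤) {δ : ℝ} (hδ0 : 0 < δ) (hδ : δ < 1 / 2) {o : Option (Fin N)}
    (hQ : (π.law ν').real (π.outputs o) ≤ δ) (n : ℕ) :
    (2 * (π.law ν).real (π.outputsBefore o n) - 1) * Real.log ((1 - δ) / δ) ≤
      ∑ a, (π.samplesOf ν a).toReal * K a := by
  classical
  set L := Real.log ((1 - δ) / δ) with hL
  have hc : 0 < (1 - δ) / δ := div_pos (by linarith) hδ0
  have hexpL : Real.exp L = (1 - δ) / δ := Real.exp_log hc
  have hexpL' : Real.exp (-L) = δ / (1 - δ) := by rw [Real.exp_neg, hexpL, inv_div]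
  set A := π.outputsBefore o n with hA
  have hAm : MeasurableSet A := π.measurableSet_outputsBefore o n
  set ψ : π.Outcome → ℝ := fun ω => if ω ∈ A then L else -L with hψ
  have hψm : Measurable ψ := Measurable.ite hAm measurable_const measurable_const
  have hψint : Integrable ψ (π.law ν) := by
    refine Integrable.of_bound hψm.aestronglyMeasurable |L| (ae_of_all _ fun ω => ?_)
    simp only [hψ]; split_ifs <;> simp
  have hψI : ∫ ω, ψ ω ∂(π.law ν) = (2 * (π.law ν).real A - 1) * L := by
    have : ψ = fun ω => A.indicator (fun _ => 2 * L) ω - L := by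
      funext ω
      by_cases hω : ω ∈ A
      · simp [hψ, hω]; ring
      · simp [hψ, hω]
    rw [this, integral_sub ((integrable_const _).indicator hAm) (integrable_const _),
      integral_indicator_const _ hAm]
    simp; ring
  set g : ∀ j, π.Seed × History N M j → ENNReal := fun j p =>
    ENNReal.ofReal (Real.exp (if j < n ∧ π.output j p = o then L else -L)) with hg
  have hgm : ∀ j, Measurable (g j) := fun j => by
    refine ENNReal.measurable_ofReal.comp (Real.measurable_exp.comp
      (Measurable.ite ?_ measurable_const measurable_const))
    exact (MeasurableSet.const _).inter (π.measurableSet_output j o)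
  have hgψ : ∀ ω, g (π.stopIdx n ω) (π.view _ ω) = ENNReal.ofReal (Real.exp (ψ ω)) := fun ω => by
    simp only [hg, hψ, hA, mem_outputsBefore_iff]
  have hq : ∫⁻ ω, ENNReal.ofReal (Real.exp (ψ ω)) ∂(π.law ν') ≤ 1 := by
    have hint : Integrable (fun ω => Real.exp (ψ ω)) (π.law ν') := by
      refine Integrable.of_bound (Real.measurable_exp.comp hψm).aestronglyMeasurable
        (Real.exp |L|) (ae_of_all _ fun ω => ?_)
      simp only [hψ, Real.norm_eq_abs, Real.abs_exp, Real.exp_le_exp]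
      split_ifs
      exacts [le_abs_self L, neg_le_abs L]
    rw [← ofReal_integral_eq_lintegral_ofReal hint (ae_of_all _ fun ω => (Real.exp_pos _).le)]
    have : (fun ω => Real.exp (ψ ω)) =
        fun ω => A.indicator (fun _ => Real.exp L - Real.exp (-L)) ω + Real.exp (-L) := by
      funext ω
      by_cases hω : ω ∈ A <;> simp [hψ, hω]
    have hqA : (π.law ν').real A ≤ δ :=
      (measureReal_mono (by
        rw [← iUnion_outputsBefore]; exact Set.subset_iUnion (π.outputsBefore o) n)).trans hQ
    rw [this, integral_add ((integrable_const _).indicator hAm) (integrable_const _),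
      integral_indicator_const _ hAm]
    simp only [smul_eq_mul, integral_const, probReal_univ, one_mul, hexpL, hexpL']
    refine ENNReal.ofReal_le_one.2 ?_
    have h1δ : 0 < 1 - δ := by linarith
    have hpos : 0 ≤ (1 - δ) / δ - δ / (1 - δ) := by
      rw [div_sub_div _ _ hδ0.ne' h1δ.ne']
      exact div_nonneg (by nlinarith) (by positivity)
    calc _ ≤ δ * ((1 - δ) / δ - δ / (1 - δ)) + δ / (1 - δ) := by gcongr
      _ = 1 := by field_simp; ring
  have hX : ∫ ω, (ψ ω - π.logLik ℓ n ω) ∂(π.law ν) ≤ 0 := by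
    refine integral_nonpos_of_lintegral_exp_le_one (hψint.sub (π.integrable_logLik h n)) ?_
    refine le_trans (le_of_eq (lintegral_congr fun ω => ?_))
      ((π.lintegral_stopIdx_mul_weight_le h n hgm).trans
        ((le_of_eq (lintegral_congr hgψ)).trans hq))
    rw [π.weight_stopIdx (fun a => (h a).pos), hgψ, ← ENNReal.ofReal_mul (Real.exp_pos _).le,
      ← Real.exp_add]
    rfl
  rw [integral_sub hψint (π.integrable_logLik h n), hψI] at hX
  linarith [π.integral_logLik_le h hfin n]

/-- The transportation inequality: a policy that can tell `ν` from `ν'` has to sample. -/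
lemma log_odds_mul_le
    (h : ∀ a : Fin N × Fin M, IsLikelihoodBound (ν a.1 a.2) (ν' a.1 a.2) (ℓ a) (K a))
    (hfin : π.expectedSamples ν ≠ ⊤) {δ : ℝ} (hδ0 : 0 < δ) (hδ : δ < 1 / 2) {o : Option (Fin N)}
    (hP : 1 - δ ≤ (π.law ν).real (π.outputs o)) (hQ : (π.law ν').real (π.outputs o) ≤ δ) :
    (1 - 2 * δ) * Real.log ((1 - δ) / δ) ≤ ∑ a, (π.samplesOf ν a).toReal * K a := by
  have hL : 0 ≤ Real.log ((1 - δ) / δ) :=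
    Real.log_nonneg (by rw [le_div_iff₀ hδ0]; linarith)
  have ht : Filter.Tendsto (fun n => (π.law ν).real (π.outputsBefore o n)) Filter.atTop
      (nhds ((π.law ν).real (π.outputs o))) := by
    rw [← iUnion_outputsBefore]
    exact (ENNReal.tendsto_toReal (measure_ne_top _ _)).comp
      (tendsto_measure_iUnion_atTop (π.monotone_outputsBefore o))
  have h1 := le_of_tendsto (((ht.const_mul 2).sub_const 1).mul_const (Real.log ((1 - δ) / δ)))
    (Filter.Eventually.of_forall fun n => π.log_odds_mul_le_of_outputsBefore h hfin hδ0 hδ hQ n)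
  refine le_trans (mul_le_mul_of_nonneg_right ?_ hL) h1
  linarith

end Policy

/-- The binary relative entropy of `δ` and `1 - δ` is at least `log (1 / (2.4 δ))`. -/
lemma log_le_log_odds_mul {δ : ℝ} (hδ0 : 0 < δ) (hδ : δ < 1 / 2) :
    Real.log (1 / (2.4 * δ)) ≤ (1 - 2 * δ) * Real.log ((1 - δ) / δ) := by
  have h1δ : 0 < 1 - δ := by linarith
  have ha : -Real.log δ ≤ 1 / (3 * δ) - 1 + Real.log 3 := by
    have := Real.log_le_sub_one_of_pos (x := 1 / (3 * δ)) (by positivity)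
    rw [one_div, Real.log_inv, Real.log_mul (by norm_num) hδ0.ne', ← one_div] at this
    linarith
  have hb : -Real.log (1 - δ) ≤ 2 / (3 * (1 - δ)) - 1 + (Real.log 3 - Real.log 2) := by
    have := Real.log_le_sub_one_of_pos (x := 2 / (3 * (1 - δ))) (by positivity)
    rw [Real.log_div (by norm_num) (by positivity), Real.log_mul (by norm_num) h1δ.ne'] at this
    linarith
  have h24 : Real.log 2.4 = 2 * Real.log 2 + Real.log 3 - Real.log 5 := by
    rw [show (2.4 : ℝ) = 2 * 2 * 3 / 5 by norm_num, Real.log_div (by norm_num) (by norm_num),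
      Real.log_mul (by norm_num) (by norm_num), Real.log_mul (by norm_num) (by norm_num)]
    ring
  have h24' : 0.87546 < Real.log 2.4 := by
    linarith [Real.log_two_gt_d9, Real.log_three_gt_d9, Real.log_five_lt_d9]
  have h15 : Real.log 3 - Real.log 2 < 0.405466 := by
    linarith [Real.log_two_gt_d9, Real.log_three_lt_d9]
  have h3 : Real.log 3 < 1.098613 := by linarith [Real.log_three_lt_d9]
  rw [one_div, Real.log_inv, Real.log_mul (by norm_num) hδ0.ne', Real.log_div h1δ.ne' hδ0.ne']
  have ha' : 2 * δ * -Real.log δ ≤ 2 / 3 + 2 * δ * 0.098613 := by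
    calc 2 * δ * -Real.log δ ≤ 2 * δ * (1 / (3 * δ) - 1 + 1.098613) := by
          gcongr; linarith
      _ = 2 / 3 + 2 * δ * 0.098613 := by field_simp; ring
  have hb' : (1 - 2 * δ) * -Real.log (1 - δ) ≤
      (1 - 2 * δ) * (2 / (3 * (1 - δ)) - 0.594534) := by
    refine mul_le_mul_of_nonneg_left ?_ (by linarith)
    linarith
  have hfrac : (1 - 2 * δ) * (2 / (3 * (1 - δ)) - 0.594534) ≤
      0.87546 - (2 / 3 + 2 * δ * 0.098613) := by
    have : (1 - 2 * δ) * (2 / (3 * (1 - δ)) - 0.594534) =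
        ((1 - 2 * δ) * (2 / 3 - 0.594534 * (1 - δ))) / (1 - δ) := by field_simp
    rw [this, div_le_iff₀ h1δ]
    nlinarith [sq_nonneg (δ - 0.31)]
  nlinarith

lemma bernoulliLaws_subset_unitLaws : bernoulliLaws ⊆ unitLaws := by
  intro p hp
  refine le_antisymm prob_le_one ?_
  rw [← show (p : Measure ℝ) {0, 1} = 1 from hp]
  refine measure_mono ?_
  rintro x (rfl | rfl) <;> simp

lemma subset_unitLaws {D : Set (ProbabilityMeasure ℝ)} (hD : D = unitLaws ∨ D = bernoulliLaws) :
    D ⊆ unitLaws := by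
  rcases hD with rfl | rfl
  exacts [subset_rfl, bernoulliLaws_subset_unitLaws]

lemma bernoulliLaws_subset {D : Set (ProbabilityMeasure ℝ)}
    (hD : D = unitLaws ∨ D = bernoulliLaws) : bernoulliLaws ⊆ D := by
  rcases hD with rfl | rfl
  exacts [bernoulliLaws_subset_unitLaws, subset_rfl]

lemma ae_mem_Icc {p : ProbabilityMeasure ℝ} (hp : p ∈ unitLaws) :
    ∀ᵐ x ∂(p : Measure ℝ), x ∈ Set.Icc (0 : ℝ) 1 :=
  (mem_ae_iff_prob_eq_one measurableSet_Icc).2 hp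

lemma integrable_id_of_mem_unitLaws {p : ProbabilityMeasure ℝ} (hp : p ∈ unitLaws) :
    Integrable (fun x : ℝ => x) (p : Measure ℝ) :=
  Integrable.of_bound measurable_id.aestronglyMeasurable 1 <| by
    filter_upwards [ae_mem_Icc hp] with x hx
    rw [Real.norm_eq_abs, abs_le]
    exact ⟨by linarith [hx.1], hx.2⟩

lemma integral_id_mem_Icc {p : ProbabilityMeasure ℝ} (hp : p ∈ unitLaws) :
    ∫ x, x ∂(p : Measure ℝ) ∈ Set.Icc (0 : ℝ) 1 := by
  constructor
  · refine integral_nonneg_of_ae ?_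
    filter_upwards [ae_mem_Icc hp] with x hx using hx.1
  · calc ∫ x, x ∂(p : Measure ℝ) ≤ ∫ _, (1 : ℝ) ∂(p : Measure ℝ) := by
          refine integral_mono_ae (integrable_id_of_mem_unitLaws hp) (integrable_const _) ?_
          filter_upwards [ae_mem_Icc hp] with x hx using hx.2
      _ = 1 := by simp

/-- The classes of laws of the theorem contain the mixtures of their elements with the laws of
the constants `0` and `1`. -/
lemma exists_mixture {D : Set (ProbabilityMeasure ℝ)} (hD : D = unitLaws ∨ D = bernoulliLaws)
    {p : ProbabilityMeasure ℝ} (hp : p ∈ D) {c : ℝ} (hc : c = 0 ∨ c = 1) {ε : ℝ}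
    (hε0 : 0 ≤ ε) (hε1 : ε ≤ 1) :
    ∃ p' ∈ D, ∫ x, x ∂(p' : Measure ℝ) = (1 - ε) * ∫ x, x ∂(p : Measure ℝ) + ε * c ∧
      ENNReal.ofReal (1 - ε) • (p : Measure ℝ) ≤ p' := by
  set μ : Measure ℝ := ENNReal.ofReal (1 - ε) • (p : Measure ℝ) + ENNReal.ofReal ε • Measure.dirac c
    with hμ
  have hε : ENNReal.ofReal (1 - ε) + ENNReal.ofReal ε = 1 := by
    rw [← ENNReal.ofReal_add (by linarith) hε0]; simp
  have hfull : ∀ s : Set ℝ, MeasurableSet s → (p : Measure ℝ) s = 1 → c ∈ s → μ s = 1 := by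
    intro s hs hps hcs
    simp [hμ, hps, Measure.dirac_apply' _ hs, hcs, hε]
  have hprob : IsProbabilityMeasure μ := ⟨hfull _ MeasurableSet.univ measure_univ trivial⟩
  refine ⟨⟨μ, hprob⟩, ?_, ?_, ?_⟩
  · rcases hD with rfl | rfl
    · exact hfull _ measurableSet_Icc hp (by rcases hc with rfl | rfl <;> simp)
    · exact hfull _ (by measurability) hp (by rcases hc with rfl | rfl <;> simp)
  · have hint : Integrable (fun x : ℝ => x) (p : Measure ℝ) :=
      integrable_id_of_mem_unitLaws (subset_unitLaws hD hp)
    have hdir : Integrable (fun x : ℝ => x) (Measure.dirac c) := integrable_dirac (by simp)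
    change ∫ x, x ∂μ = _
    rw [hμ, integral_add_measure (hint.smul_measure ENNReal.ofReal_ne_top)
      (hdir.smul_measure ENNReal.ofReal_ne_top), integral_smul_measure, integral_smul_measure,
      integral_dirac, ENNReal.toReal_ofReal (by linarith), ENNReal.toReal_ofReal hε0]
    rfl
  · exact Measure.le_add_right le_rfl

lemma exists_bernoulliLaw {q : ℝ} (hq0 : 0 ≤ q) (hq1 : q ≤ 1) :
    ∃ p ∈ bernoulliLaws, ∫ x, x ∂(p : Measure ℝ) = q := by
  have h0 : (⟨Measure.dirac 0, inferInstance⟩ : ProbabilityMeasure ℝ) ∈ bernoulliLaws := by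
    change Measure.dirac (0 : ℝ) {0, 1} = 1
    simp
  obtain ⟨p, hp, hmean, -⟩ := exists_mixture (Or.inr rfl) h0 (Or.inr rfl) hq0 hq1
  exact ⟨p, hp, by simpa using hmean⟩

lemma bernoulliLaw_eq {p : ProbabilityMeasure ℝ} (hp : p ∈ bernoulliLaws) :
    (p : Measure ℝ) =
      ENNReal.ofReal (1 - ∫ x, x ∂(p : Measure ℝ)) • Measure.dirac 0 +
        ENNReal.ofReal (∫ x, x ∂(p : Measure ℝ)) • Measure.dirac 1 := by
  have hp' : (p : Measure ℝ) {0, 1} = 1 := hp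
  have hdisj : Disjoint ({0} : Set ℝ) {1} := by simp
  have h1 : (p : Measure ℝ) = (p : Measure ℝ) {0} • Measure.dirac 0 +
      (p : Measure ℝ) {1} • Measure.dirac 1 := by
    have hae : ∀ᵐ x ∂(p : Measure ℝ), x ∈ ({0, 1} : Set ℝ) :=
      (mem_ae_iff_prob_eq_one (by measurability)).2 hp'
    conv_lhs => rw [← Measure.restrict_eq_self_of_ae_mem hae]
    rw [Set.insert_eq, Measure.restrict_union hdisj (measurableSet_singleton _),
      Measure.restrict_singleton, Measure.restrict_singleton]
  have hmean : ∫ x, x ∂(p : Measure ℝ) = ((p : Measure ℝ) {1}).toReal := by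
    have hi : ∀ c : ℝ, Integrable (fun x : ℝ => x) ((p : Measure ℝ) {c} • Measure.dirac c) :=
      fun c => (integrable_dirac (by simp)).smul_measure (measure_ne_top _ _)
    conv_lhs => rw [h1]
    rw [integral_add_measure (hi 0) (hi 1), integral_smul_measure, integral_smul_measure,
      integral_dirac, integral_dirac]
    simp
  have hsum : (p : Measure ℝ) {0} + (p : Measure ℝ) {1} = 1 := by
    rw [← measure_union hdisj (measurableSet_singleton _), ← Set.insert_eq, hp']
  have h0 : (p : Measure ℝ) {0} = ENNReal.ofReal (1 - ∫ x, x ∂(p : Measure ℝ)) := by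
    rw [hmean, ENNReal.ofReal_sub _ ENNReal.toReal_nonneg,
      ENNReal.ofReal_toReal (measure_ne_top _ _),
      ENNReal.ofReal_one, ← hsum, ENNReal.add_sub_cancel_right (measure_ne_top _ _)]
  have h2 : (p : Measure ℝ) {1} = ENNReal.ofReal (∫ x, x ∂(p : Measure ℝ)) := by
    rw [hmean, ENNReal.ofReal_toReal (measure_ne_top _ _)]
  rw [← h0, ← h2]
  exact h1

lemma isLikelihoodBound_of_smul_le {p p' : ProbabilityMeasure ℝ} {ε : ℝ} (hε0 : 0 ≤ ε)
    (hε1 : ε < 1) (h : ENNReal.ofReal (1 - ε) • (p : Measure ℝ) ≤ p') :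
    IsLikelihoodBound p p' (fun _ => 1 - ε) (-Real.log (1 - ε)) where
  measurable := measurable_const
  pos _ := by linarith
  bounded := ⟨_, fun _ => le_rfl⟩
  withDensity_le := by rwa [withDensity_const]
  nonneg := by linarith [Real.log_nonpos (x := 1 - ε) (by linarith) (by linarith)]
  integral_le := by simp

lemma isLikelihoodBound_refl (p : ProbabilityMeasure ℝ) :
    IsLikelihoodBound p p (fun _ => 1) 0 where
  measurable := measurable_const
  pos _ := one_pos
  bounded := ⟨0, by simp⟩
  withDensity_le := by simp
  nonneg := le_rfl
  integral_le := by simp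

/-- The Kullback-Leibler divergence of Bernoulli laws is bounded by their `χ²`-divergence. -/
lemma exists_isLikelihoodBound_bernoulli {p p' : ProbabilityMeasure ℝ} (hp : p ∈ bernoulliLaws)
    (hp' : p' ∈ bernoulliLaws) {m q : ℝ} (hm : ∫ x, x ∂(p : Measure ℝ) = m)
    (hq : ∫ x, x ∂(p' : Measure ℝ) = q) (hq0 : 0 < q) (hq1 : q < 1) :
    ∃ ℓ, IsLikelihoodBound p p' ℓ ((m - q) ^ 2 / (q * (1 - q))) := by
  have hpm := bernoulliLaw_eq hp
  have hpq := bernoulliLaw_eq hp'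
  obtain ⟨hm0, hm1⟩ := integral_id_mem_Icc (bernoulliLaws_subset_unitLaws hp)
  rw [hm] at hpm hm0 hm1
  rw [hq] at hpq
  set u : ℝ := if m = 0 then 1 else q / m with hu
  set v : ℝ := if m = 1 then 1 else (1 - q) / (1 - m) with hv
  have hupos : 0 < u := by
    simp only [hu]; split_ifs with h
    · exact one_pos
    · exact div_pos hq0 (lt_of_le_of_ne hm0 (Ne.symm h))
  have hvpos : 0 < v := by
    simp only [hv]; split_ifs with h
    · exact one_pos
    · exact div_pos (by linarith) (by linarith [lt_of_le_of_ne hm1 h])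
  have humul : m * u ≤ q := by
    simp only [hu]; split_ifs with h
    · simp [h, hq0.le]
    · rw [mul_div_cancel₀ _ h]
  have hvmul : (1 - m) * v ≤ 1 - q := by
    simp only [hv]; split_ifs with h
    · simp [h, hq1.le]
    · rw [mul_div_cancel₀ _ (sub_ne_zero.2 (Ne.symm h))]
  have hulog : m * -Real.log u ≤ m * (m / q - 1) := by
    by_cases h : m = 0
    · simp [h]
    · refine mul_le_mul_of_nonneg_left ?_ hm0
      have := Real.log_le_sub_one_of_pos (x := u⁻¹) (inv_pos.2 hupos)
      rw [Real.log_inv] at this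
      simpa [hu, h] using this
  have hvlog : (1 - m) * -Real.log v ≤ (1 - m) * ((1 - m) / (1 - q) - 1) := by
    by_cases h : m = 1
    · simp [h]
    · refine mul_le_mul_of_nonneg_left ?_ (by linarith)
      have := Real.log_le_sub_one_of_pos (x := v⁻¹) (inv_pos.2 hvpos)
      rw [Real.log_inv] at this
      simpa [hv, h] using this
  have hq1' : 0 < 1 - q := by linarith
  set ℓ : ℝ → ℝ := fun x => if x = 1 then u else v with hℓ
  have hℓm : Measurable ℓ :=
    Measurable.ite (measurableSet_singleton (1 : ℝ)) measurable_const measurable_const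
  refine ⟨ℓ, hℓm, ?_, ⟨max |Real.log u| |Real.log v|, ?_⟩, ?_, by positivity, ?_⟩
  · intro x; simp only [hℓ]; split_ifs <;> assumption
  · intro x; simp only [hℓ]; split_ifs
    exacts [le_max_left _ _, le_max_right _ _]
  · refine Measure.le_iff.2 fun s hs => ?_
    have hf : Measurable (s.indicator fun x => ENNReal.ofReal (ℓ x)) :=
      (ENNReal.measurable_ofReal.comp hℓm).indicator hs
    rw [withDensity_apply _ hs, ← lintegral_indicator hs, hpm, hpq, lintegral_add_measure,
      lintegral_smul_measure, lintegral_smul_measure, lintegral_dirac' _ hf, lintegral_dirac' _ hf]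
    simp only [Measure.add_apply, Measure.smul_apply, smul_eq_mul, Measure.dirac_apply' _ hs]
    have hc : ∀ (c : ℝ) (a b w : ℝ), 0 ≤ a → ℓ c = w → a * w ≤ b →
        ENNReal.ofReal a * s.indicator (fun x => ENNReal.ofReal (ℓ x)) c ≤
          ENNReal.ofReal b * s.indicator 1 c := by
      intro c a b w ha hw hab
      by_cases hcs : c ∈ s
      · simp only [Set.indicator_of_mem hcs, hw, Pi.one_apply, mul_one]
        rw [← ENNReal.ofReal_mul ha]
        exact ENNReal.ofReal_le_ofReal hab
      · simp [hcs]
    exact add_le_add (hc 0 _ _ v (by linarith) (by simp [hℓ]) hvmul)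
      (hc 1 _ _ u hm0 (by simp [hℓ]) humul)
  · have hi : ∀ (r c : ℝ), Integrable (fun x : ℝ => -Real.log (ℓ x))
        (ENNReal.ofReal r • Measure.dirac c) := fun r c =>
      (integrable_dirac (by simp)).smul_measure ENNReal.ofReal_ne_top
    rw [hpm, integral_add_measure (hi _ _) (hi _ _), integral_smul_measure, integral_smul_measure,
      integral_dirac, integral_dirac, ENNReal.toReal_ofReal (by linarith),
      ENNReal.toReal_ofReal hm0]
    have e0 : ℓ 0 = v := by simp [hℓ]
    have e1 : ℓ 1 = u := by simp [hℓ]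
    rw [e0, e1, smul_eq_mul, smul_eq_mul]
    calc _ ≤ (1 - m) * ((1 - m) / (1 - q) - 1) + m * (m / q - 1) := add_le_add hvlog hulog
      _ = (m - q) ^ 2 / (q * (1 - q)) := by field_simp; ring

namespace Policy

variable {N M : ℕ} [NeZero M] {π : Policy N M} {D : Set (ProbabilityMeasure ℝ)} {θ δ : ℝ}

/-- The transportation inequality for a `δ`-PAC policy and two instances with different answers. -/
lemma IsPAC.log_le (hπ : π.IsPAC D θ δ) (hδ0 : 0 < δ) (hδ : δ < 1 / 2) {ν ν' : Env N M}
    (hν : ∀ i j, ν i j ∈ D) (hν' : ∀ i j, ν' i j ∈ D) (hreg : IsRegular ν θ)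
    (hreg' : IsRegular ν' θ) (hne : bestArm ν θ ≠ bestArm ν' θ)
    (hfin : π.expectedSamples ν ≠ ⊤) {K : Fin N × Fin M → ℝ}
    (h : ∀ a : Fin N × Fin M, ∃ ℓ, IsLikelihoodBound (ν a.1 a.2) (ν' a.1 a.2) ℓ (K a)) :
    Real.log (1 / (2.4 * δ)) ≤ ∑ a, (π.samplesOf ν a).toReal * K a := by
  choose ℓ hℓ using h
  have hP : ∀ ν : Env N M, (∀ i j, ν i j ∈ D) → IsRegular ν θ →
      1 - δ ≤ (π.law ν).real (π.outputs (bestArm ν θ)) := fun ν h1 h2 =>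
    (ENNReal.ofReal_le_iff_le_toReal (measure_ne_top _ _)).1 (hπ ν h1 h2)
  refine (log_le_log_odds_mul hδ0 hδ).trans
    (π.log_odds_mul_le hℓ hfin hδ0 hδ (hP ν hν hreg) ?_)
  have h1 := hP ν' hν' hreg'
  have h2 : (π.law ν').real (π.outputs (bestArm ν θ) ∪ π.outputs (bestArm ν' θ)) ≤ 1 :=
    measureReal_le_one
  rw [measureReal_union (π.disjoint_outputs hne) (π.measurableSet_outputs _)] at h2
  linarith

end Policy
lemma attrMean_mem_Icc {N M : ℕ} {ν : Env N M} (hν : ∀ i j, ν i j ∈ unitLaws) (i : Fin N)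
    (j : Fin M) : attrMean ν i j ∈ Set.Icc (0 : ℝ) 1 := integral_id_mem_Icc (hν i j)

section Instance

variable {N M : ℕ} [NeZero M] {ν : Env N M} {θ : ℝ}

lemma mem_feasible_iff {i : Fin N} : i ∈ feasible ν θ ↔ ∀ j, θ ≤ attrMean ν i j := by
  simp [feasible, minAttrMean, Finset.le_inf'_iff]

lemma minAttrMean_le (i : Fin N) (j : Fin M) : minAttrMean ν i ≤ attrMean ν i j :=
  Finset.inf'_le _ (Finset.mem_univ j)

lemma exists_minAttrMean_eq (i : Fin N) : ∃ j, minAttrMean ν i = attrMean ν i j := by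
  obtain ⟨j, -, h⟩ := Finset.exists_mem_eq_inf' Finset.univ_nonempty (attrMean ν i)
  exact ⟨j, h⟩

lemma lt_minAttrMean {i : Fin N} {c : ℝ} (h : ∀ j, c < attrMean ν i j) : c < minAttrMean ν i := by
  obtain ⟨j, hj⟩ := exists_minAttrMean_eq (ν := ν) i
  rw [hj]; exact h j

lemma card_pos_real : (0 : ℝ) < M := Nat.cast_pos.2 (NeZero.pos M)

lemma le_armMean {i : Fin N} {c : ℝ} (h : ∀ j, c ≤ attrMean ν i j) : c ≤ armMean ν i := by
  rw [armMean, le_div_iff₀ card_pos_real]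
  calc c * M = ∑ _j : Fin M, c := by simp [mul_comm]
    _ ≤ _ := Finset.sum_le_sum fun j _ => h j

lemma armMean_le {i : Fin N} {c : ℝ} (h : ∀ j, attrMean ν i j ≤ c) : armMean ν i ≤ c := by
  rw [armMean, div_le_iff₀ card_pos_real]
  calc _ ≤ ∑ _j : Fin M, c := Finset.sum_le_sum fun j _ => h j
    _ = c * M := by simp [mul_comm]

lemma armMean_mem_Icc (hν : ∀ i j, ν i j ∈ unitLaws) (i : Fin N) :
    armMean ν i ∈ Set.Icc (0 : ℝ) 1 :=
  ⟨le_armMean fun j => (attrMean_mem_Icc hν i j).1, armMean_le fun j => (attrMean_mem_Icc hν i j).2⟩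

lemma bestArm_eq_some_iff {i : Fin N} : bestArm ν θ = some i ↔ IsBestArm ν θ i := by
  constructor
  · intro h
    unfold bestArm at h
    split_ifs at h with hex
    rw [← Option.some.inj h]
    exact hex.choose_spec
  · intro h
    have hex : ∃ i, IsBestArm ν θ i := ⟨i, h⟩
    rw [bestArm, dif_pos hex, Option.some_inj]
    by_contra hne
    exact lt_asymm (h.2 _ hex.choose_spec.1 hne) (hex.choose_spec.2 _ h.1 (Ne.symm hne))

lemma bestArm_eq_none_of_feasible_eq_empty (h : feasible ν θ = ∅) : bestArm ν θ = none := by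
  rw [bestArm, dif_neg]
  rintro ⟨i, hi, -⟩
  rw [h] at hi; exact hi

lemma IsRegular.feasible_eq_empty (hreg : IsRegular ν θ) (h : bestArm ν θ = none) :
    feasible ν θ = ∅ := by
  rcases hreg with h' | ⟨i, hi, -⟩
  · exact h'
  · rw [bestArm_eq_some_iff.2 hi] at h; cases h

lemma isRegular_of_forall_lt {b : Fin N} (h : ∀ j, θ < attrMean ν b j)
    (h' : ∀ k ∈ feasible ν θ, k ≠ b → armMean ν k < armMean ν b) :
    IsRegular ν θ ∧ bestArm ν θ = some b := by
  have hb : IsBestArm ν θ b := ⟨mem_feasible_iff.2 fun j => (h j).le, h'⟩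
  exact ⟨Or.inr ⟨b, hb, (lt_minAttrMean h).ne'⟩, bestArm_eq_some_iff.2 hb⟩

lemma isRegular_of_infeasible (h : ∀ i, ∃ j, attrMean ν i j < θ) :
    IsRegular ν θ ∧ bestArm ν θ = none := by
  have : feasible ν θ = ∅ := by
    ext i
    obtain ⟨j, hj⟩ := h i
    simp only [mem_feasible_iff, Set.mem_empty_iff_false, iff_false]
    exact fun hi => (hi j).not_gt hj
  exact ⟨Or.inl this, bestArm_eq_none_of_feasible_eq_empty this⟩

lemma hardness_nonneg : 0 ≤ hardness ν θ := by
  have hb : 0 ≤ bestTerm ν θ := by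
    unfold bestTerm
    split
    · exact le_rfl
    · split_ifs <;> positivity
  have hs : ∀ (s : Finset (Fin N)) (f : Fin N → ℝ), 0 ≤ ∑ i ∈ s, 1 / f i ^ 2 := fun s f =>
    Finset.sum_nonneg fun i _ => by positivity
  exact add_nonneg (add_nonneg (add_nonneg hb (hs _ _)) (hs _ _)) (hs _ _)

/-- Every regular instance has an alternative with another answer at a finite distance. -/
lemma exists_alternative [NeZero N] {D : Set (ProbabilityMeasure ℝ)}
    (hD : D = unitLaws ∨ D = bernoulliLaws) (hθ0 : 0 < θ ∨ 2 ≤ N) (hθ1 : θ < 1)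
    (hν : ∀ i j, ν i j ∈ D) :
    ∃ (ν' : Env N M) (ε : ℝ), (∀ i j, ν' i j ∈ D) ∧ 0 ≤ ε ∧ ε < 1 ∧
      (∀ i j, ENNReal.ofReal (1 - ε) • (ν i j : Measure ℝ) ≤ ν' i j) ∧
      IsRegular ν' θ ∧ bestArm ν θ ≠ bestArm ν' θ := by
  have hν1 : ∀ i j, ν i j ∈ unitLaws := fun i j => subset_unitLaws hD (hν i j)
  have hcase : (∃ k, bestArm ν θ ≠ some k) ∨ (bestArm ν θ ≠ none ∧ 0 < θ) := by
    rcases hb : bestArm ν θ with _ | b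
    · exact Or.inl ⟨0, by simp⟩
    · rcases hθ0 with h | h
      · exact Or.inr ⟨by simp, h⟩
      · have : Nontrivial (Fin N) := Fin.nontrivial_iff_two_le.2 h
        obtain ⟨k, hk⟩ := exists_ne b
        exact Or.inl ⟨k, by simpa using hk.symm⟩
  rcases hcase with ⟨k, hk⟩ | ⟨hb, hθ⟩
  · set ε : ℝ := max (2 / 3) ((1 + θ) / 2) with hε
    have hε1 : ε < 1 := max_lt (by norm_num) (by linarith)
    have hε2 : 2 / 3 ≤ ε := le_max_left _ _
    have hεθ : θ < ε := lt_of_lt_of_le (by linarith) (le_max_right _ _)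
    choose ν' hν'D hmean hle using fun i j => exists_mixture hD (hν i j)
      (c := if i = k then 1 else 0) (by split_ifs <;> simp) (ε := ε) (by linarith) hε1.le
    have hmk : ∀ j, ε ≤ attrMean ν' k j := fun j => by
      have := (attrMean_mem_Icc hν1 k j).1
      have h2 := hmean k j
      simp only [if_true, mul_one] at h2
      unfold attrMean at *
      rw [h2]; nlinarith
    have hmi : ∀ i ≠ k, ∀ j, attrMean ν' i j ≤ 1 - ε := fun i hi j => by
      have := (attrMean_mem_Icc hν1 i j).2
      have h2 := hmean i j
      simp only [if_neg hi, mul_zero, add_zero] at h2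
      unfold attrMean at *
      rw [h2]; nlinarith
    obtain ⟨h1, h2⟩ := isRegular_of_forall_lt (ν := ν') (θ := θ) (b := k)
      (fun j => hεθ.trans_le (hmk j)) fun i _ hi =>
        (armMean_le (hmi i hi)).trans_lt ((by linarith : 1 - ε < ε).trans_le (le_armMean hmk))
    exact ⟨ν', ε, hν'D, by linarith, hε1, hle, h1, by rwa [h2]⟩
  · have hε1 : 1 - θ / 2 < 1 := by linarith
    choose ν' hν'D hmean hle using fun i j => exists_mixture hD (hν i j)
      (c := 0) (Or.inl rfl) (ε := 1 - θ / 2) (by linarith) hε1.le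
    obtain ⟨h1, h2⟩ := isRegular_of_infeasible (ν := ν') (θ := θ) fun i => ⟨0, by
      have := (attrMean_mem_Icc hν1 i 0).2
      have h2 := hmean i 0
      unfold attrMean at *
      rw [h2]; nlinarith⟩
    exact ⟨ν', _, hν'D, by linarith, hε1, hle, h1, by rwa [h2]⟩

end Instance

variable {N M : ℕ} [NeZero M] {ν : Env N M} {D : Set (ProbabilityMeasure ℝ)} {θ : ℝ}

/-- The lower bound with an unspecified constant. -/
lemma exists_lower_bound [NeZero N] (hD : D = unitLaws ∨ D = bernoulliLaws)
    (hθ0 : 0 < θ ∨ 2 ≤ N) (hθ1 : θ < 1) (hν : ∀ i j, ν i j ∈ D) (hreg : IsRegular ν θ) :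
    ∃ C : ℝ, 0 < C ∧ ∀ δ : ℝ, 0 < δ → δ < 1 / 2 → 0 ≤ Real.log (1 / (2.4 * δ)) →
      ∀ π : Policy N M, π.IsPAC D θ δ → π.expectedSamples ν ≠ ⊤ →
        Real.log (1 / (2.4 * δ)) * C * hardness ν θ ≤ (π.expectedSamples ν).toReal := by
  obtain ⟨ν', ε, hν', hε0, hε1, hle, hreg', hne⟩ := exists_alternative hD hθ0 hθ1 hν
  set K := -Real.log (1 - ε) with hK
  have hK0 : 0 ≤ K := by linarith [Real.log_nonpos (x := 1 - ε) (by linarith) (by linarith)]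
  have hH : 0 ≤ hardness ν θ := hardness_nonneg
  refine ⟨1 / ((K + 1) * (hardness ν θ + 1)), by positivity, ?_⟩
  intro δ hδ0 hδ hlog π hπ hfin
  have h1 := hπ.log_le hδ0 hδ hν hν' hreg hreg' hne hfin (K := fun _ => K)
    fun a => ⟨_, isLikelihoodBound_of_smul_le hε0 hε1 (hle a.1 a.2)⟩
  have h2 : ∑ a, (π.samplesOf ν a).toReal ≤ (π.expectedSamples ν).toReal := by
    rw [← ENNReal.toReal_sum fun a _ => π.samplesOf_ne_top hfin a]
    exact ENNReal.toReal_mono hfin (π.sum_samplesOf_le ν)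
  rw [← Finset.sum_mul] at h1
  set E := (π.expectedSamples ν).toReal
  have hE : 0 ≤ E := ENNReal.toReal_nonneg
  have h3 : Real.log (1 / (2.4 * δ)) ≤ E * (K + 1) :=
    h1.trans ((mul_le_mul_of_nonneg_right h2 hK0).trans (by nlinarith))
  calc Real.log (1 / (2.4 * δ)) * (1 / ((K + 1) * (hardness ν θ + 1))) * hardness ν θ
      ≤ (E * (K + 1)) * (1 / ((K + 1) * (hardness ν θ + 1))) * (hardness ν θ + 1) := by
        gcongr; linarith
    _ = E := by field_simp

end GroupedBandit

namespace GroupedBandit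

open Filter Topology

lemma armMean_congr {N M : ℕ} {ν ν' : Env N M} {i : Fin N}
    (h : ∀ j, attrMean ν' i j = attrMean ν i j) :
    armMean ν' i = armMean ν i := by
  simp [armMean, h]

/-- The expected number of samples of arm `i`, as a real number. -/
def armSamples {N M : ℕ} (π : Policy N M) (ν : Env N M) (i : Fin N) : ℝ :=
  ∑ j, (π.samplesOf ν (i, j)).toReal

lemma armSamples_nonneg {N M : ℕ} {ν : Env N M} {π : Policy N M} (i : Fin N) :
    0 ≤ armSamples π ν i :=
  Finset.sum_nonneg fun _ _ => ENNReal.toReal_nonneg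

lemma sum_armSamples_le {N M : ℕ} {ν : Env N M} {π : Policy N M}
    (hfin : π.expectedSamples ν ≠ ⊤) :
    ∑ i, armSamples π ν i ≤ (π.expectedSamples ν).toReal := by
  unfold armSamples
  rw [← Fintype.sum_prod_type' fun i j => (π.samplesOf ν (i, j)).toReal,
    ← ENNReal.toReal_sum fun a _ => π.samplesOf_ne_top hfin a]
  exact ENNReal.toReal_mono hfin (π.sum_samplesOf_le ν)

variable {N M : ℕ} [NeZero M] {ν : Env N M} {D : Set (ProbabilityMeasure ℝ)} {θ δ : ℝ}
  {π : Policy N M}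

/-- The transportation inequality for Bernoulli rewards, with an alternative that is given by its
attribute means. -/
lemma Policy.IsPAC.log_le_of_means (hπ : π.IsPAC D θ δ) (hD : D = unitLaws ∨ D = bernoulliLaws)
    (hδ0 : 0 < δ) (hδ : δ < 1 / 2) (hν : ∀ i j, ν i j ∈ bernoulliLaws) (hreg : IsRegular ν θ)
    (hfin : π.expectedSamples ν ≠ ⊤) (m : Fin N → Fin M → ℝ)
    (hm : ∀ i j, m i j = attrMean ν i j ∨ 0 < m i j ∧ m i j < 1)
    (halt : ∀ ν' : Env N M, (∀ i j, attrMean ν' i j = m i j) →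
      IsRegular ν' θ ∧ bestArm ν θ ≠ bestArm ν' θ) :
    Real.log (1 / (2.4 * δ)) ≤ ∑ i, ∑ j, (π.samplesOf ν (i, j)).toReal *
      ((attrMean ν i j - m i j) ^ 2 / (m i j * (1 - m i j))) := by
  have hex : ∀ i j, ∃ p ∈ bernoulliLaws, ∫ x, x ∂(p : Measure ℝ) = m i j ∧
      ∃ ℓ, IsLikelihoodBound (ν i j) p ℓ
        ((attrMean ν i j - m i j) ^ 2 / (m i j * (1 - m i j))) := by
    intro i j
    rcases hm i j with h | ⟨h0, h1⟩
    · refine ⟨ν i j, hν i j, h.symm, fun _ => 1, ?_⟩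
      rw [h, sub_self]
      simpa using isLikelihoodBound_refl (ν i j)
    · obtain ⟨p, hp, hmean⟩ := exists_bernoulliLaw h0.le h1.le
      exact ⟨p, hp, hmean, exists_isLikelihoodBound_bernoulli (hν i j) hp rfl hmean h0 h1⟩
  choose ν' hν' hmean hℓ using hex
  obtain ⟨hreg', hne⟩ := halt ν' hmean
  rw [← Fintype.sum_prod_type' fun i j => (π.samplesOf ν (i, j)).toReal *
      ((attrMean ν i j - m i j) ^ 2 / (m i j * (1 - m i j)))]
  exact hπ.log_le hδ0 hδ (fun i j => bernoulliLaws_subset hD (hν i j))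
    (fun i j => bernoulliLaws_subset hD (hν' i j)) hreg hreg' hne hfin fun a => hℓ a.1 a.2

/-- The `χ²`-divergence of the raised attribute mean `max c (p + (1 - p) s)` from `p`. -/
lemma chiSq_raise_le {p c s r : ℝ} (hp0 : 0 ≤ p) (hp1 : p ≤ 1) (hc0 : 0 < c) (hc1 : c < 1)
    (hs0 : 0 ≤ s) (hs1 : s < 1) (hr : c - p ≤ r) :
    (p - max c (p + (1 - p) * s)) ^ 2 /
        (max c (p + (1 - p) * s) * (1 - max c (p + (1 - p) * s))) ≤
      max (r ^ 2 / (c * (1 - c))) (s ^ 2 / (c * (1 - s))) := by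
  have hc1' : 0 < 1 - c := by linarith
  have hs1' : 0 < 1 - s := by linarith
  rcases le_total (p + (1 - p) * s) c with h | h
  · rw [max_eq_left h]
    refine le_trans ?_ (le_max_left _ _)
    have hpc : 0 ≤ c - p := by nlinarith
    have : (p - c) ^ 2 ≤ r ^ 2 := by nlinarith
    gcongr
  · rw [max_eq_right h]
    refine le_trans ?_ (le_max_right _ _)
    rcases hp1.eq_or_lt with rfl | hp1
    · simp; positivity
    set q := p + (1 - p) * s with hq
    have hp1' : 0 < 1 - p := by linarith
    have hq0 : 0 < q := hc0.trans_le h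
    have h1q : 1 - q = (1 - p) * (1 - s) := by rw [hq]; ring
    have e : (p - q) ^ 2 / (q * (1 - q)) = (1 - p) * s ^ 2 / (q * (1 - s)) := by
      rw [h1q, hq]; field_simp; ring
    rw [e, div_le_div_iff₀ (by positivity) (by positivity)]
    have hpc : (1 - p) * c ≤ q := le_trans (by nlinarith) h
    calc (1 - p) * s ^ 2 * (c * (1 - s)) = ((1 - p) * c) * (s ^ 2 * (1 - s)) := by ring
      _ ≤ q * (s ^ 2 * (1 - s)) := by gcongr
      _ = _ := by ring

lemma armMean_le_of_bestArm_eq {b k : Fin N} (hb : bestArm ν θ = some b)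
    (hk : k ∈ feasible ν θ) : armMean ν k ≤ armMean ν b := by
  by_cases h : k = b
  · rw [h]
  · exact ((bestArm_eq_some_iff.1 hb).2 k hk h).le

lemma le_apply_zero_of_forall_pos {F : ℝ → ℝ} {c ε : ℝ} (hε : 0 < ε) (hF : ContinuousAt F 0)
    (h : ∀ η, 0 < η → η < ε → c ≤ F η) : c ≤ F 0 := by
  refine ge_of_tendsto (hF.tendsto.mono_left nhdsWithin_le_nhds : Tendsto F (𝓝[>] 0) _) ?_
  filter_upwards [Ioo_mem_nhdsGT hε] with η hη using h η hη.1 hη.2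

/-- The number of samples that are needed to rule out that arm `i` is best, after its attribute
means have been raised. -/
lemma log_le_of_raise (hπ : π.IsPAC D θ δ) (hD : D = unitLaws ∨ D = bernoulliLaws)
    (hδ0 : 0 < δ) (hδ : δ < 1 / 2) (hν : ∀ i j, ν i j ∈ bernoulliLaws) (hreg : IsRegular ν θ)
    (hfin : π.expectedSamples ν ≠ ⊤) (hθ0 : 0 < θ)
    {i : Fin N} (hi : bestArm ν θ ≠ some i) {c s r : ℝ} (hθc : θ < c)
    (hc1 : c < 1) (hs0 : 0 ≤ s) (hs1 : s < 1) (hr : ∀ j, c - attrMean ν i j ≤ r)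
    (hbest : ∀ b, bestArm ν θ = some b →
      armMean ν b < (∑ j, max c (attrMean ν i j + (1 - attrMean ν i j) * s)) / M) :
    Real.log (1 / (2.4 * δ)) ≤
      armSamples π ν i * max (r ^ 2 / (c * (1 - c))) (s ^ 2 / (c * (1 - s))) := by
  have hIcc := fun i j => attrMean_mem_Icc (fun i j => bernoulliLaws_subset_unitLaws (hν i j)) i j
  set m : Fin N → Fin M → ℝ := fun k j =>
    if k = i then max c (attrMean ν k j + (1 - attrMean ν k j) * s) else attrMean ν k j with hm
  have hmi : ∀ j, m i j = max c (attrMean ν i j + (1 - attrMean ν i j) * s) := by simp [hm]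
  have hmk : ∀ k ≠ i, ∀ j, m k j = attrMean ν k j := fun k hk j => by simp [hm, hk]
  refine (hπ.log_le_of_means hD hδ0 hδ hν hreg hfin m ?_ ?_).trans ?_
  · intro k j
    by_cases hk : k = i
    · subst hk
      rw [hmi]
      obtain ⟨h0, h1⟩ := hIcc k j
      rcases h1.eq_or_lt with h1 | h1
      · left; rw [h1]; simpa using hc1.le
      · exact Or.inr ⟨lt_max_of_lt_left (hθ0.trans hθc), max_lt hc1 (by nlinarith)⟩
    · exact Or.inl (hmk k hk j)
  · intro ν' hν'
    have hi' : armMean ν' i = (∑ j, max c (attrMean ν i j + (1 - attrMean ν i j) * s)) / M := by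
      simp [armMean, hν', hmi]
    obtain ⟨h1, h2⟩ := isRegular_of_forall_lt (ν := ν') (θ := θ) (b := i)
      (fun j => by rw [hν', hmi]; exact lt_max_of_lt_left hθc) fun k hk hki => by
        have hka : ∀ j, attrMean ν' k j = attrMean ν k j := fun j => by rw [hν', hmk k hki]
        have hkf : k ∈ feasible ν θ := by
          rw [mem_feasible_iff] at hk ⊢
          exact fun j => hka j ▸ hk j
        rcases hb : bestArm ν θ with _ | b
        · rw [hreg.feasible_eq_empty hb] at hkf
          exact hkf.elim
        · rw [armMean_congr hka, hi']
          exact (armMean_le_of_bestArm_eq hb hkf).trans_lt (hbest b hb)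
    exact ⟨h1, by rwa [h2]⟩
  · rw [Finset.sum_eq_single i, armSamples, Finset.sum_mul]
    · refine Finset.sum_le_sum fun j _ => mul_le_mul_of_nonneg_left ?_ ENNReal.toReal_nonneg
      rw [hmi]
      exact chiSq_raise_le (hIcc i j).1 (hIcc i j).2 (hθ0.trans hθc) hc1 hs0 hs1 (hr j)
    · intro k _ hk
      exact Finset.sum_eq_zero fun j _ => by simp [hmk k hk]
    · simp

/-- The samples of an infeasible arm that would be best if it were feasible. -/
lemma log_le_of_risky (hπ : π.IsPAC D θ δ) (hD : D = unitLaws ∨ D = bernoulliLaws)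
    (hδ0 : 0 < δ) (hδ : δ < 1 / 2) (hν : ∀ i j, ν i j ∈ bernoulliLaws) (hreg : IsRegular ν θ)
    (hfin : π.expectedSamples ν ≠ ⊤) (hθ0 : 0 < θ) (hθ1 : θ < 1)
    {i : Fin N} (hi : i ∉ feasible ν θ)
    (hbest : ∀ b, bestArm ν θ = some b → armMean ν b ≤ armMean ν i) :
    Real.log (1 / (2.4 * δ)) ≤ armSamples π ν i * (attrGap ν θ i ^ 2 / (θ * (1 - θ))) := by
  have hmin : minAttrMean ν i < θ := not_le.1 hi
  have hgap : attrGap ν θ i = θ - minAttrMean ν i := by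
    rw [attrGap, abs_sub_comm, abs_of_pos (by linarith)]
  have hib : bestArm ν θ ≠ some i := fun h => hi (bestArm_eq_some_iff.1 h).1
  have hne : θ * (1 - θ) ≠ 0 := mul_ne_zero hθ0.ne' (by linarith)
  have hF : ContinuousAt (fun η => armSamples π ν i *
      ((attrGap ν θ i + η) ^ 2 / ((θ + η) * (1 - (θ + η))))) 0 :=
    continuousAt_const.mul (ContinuousAt.div (by fun_prop) (by fun_prop) (by simpa using hne))
  have key := le_apply_zero_of_forall_pos (c := Real.log (1 / (2.4 * δ))) (sub_pos.2 hθ1) hF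
    fun η hη0 hη1 => ?_
  · simpa using key
  have h := log_le_of_raise hπ hD hδ0 hδ hν hreg hfin hθ0 hib (c := θ + η) (s := 0)
    (r := attrGap ν θ i + η) (by linarith) (by linarith) le_rfl one_pos
    (fun j => by linarith [minAttrMean_le (ν := ν) i j]) fun b hb => by
      refine (hbest b hb).trans_lt ?_
      rw [armMean]
      refine div_lt_div_of_pos_right ?_ card_pos_real
      obtain ⟨j, hj⟩ := exists_minAttrMean_eq (ν := ν) i
      refine Finset.sum_lt_sum (fun j _ => by simp) ⟨j, Finset.mem_univ j, ?_⟩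
      exact lt_max_of_lt_left (by linarith)
  have hpos : 0 ≤ (attrGap ν θ i + η) ^ 2 / ((θ + η) * (1 - (θ + η))) :=
    div_nonneg (sq_nonneg _) (mul_nonneg (by linarith) (by linarith))
  simpa [max_eq_left hpos] using h

/-- The samples of an arm with a smaller mean than the best arm. -/
lemma log_le_of_lt (hπ : π.IsPAC D θ δ) (hD : D = unitLaws ∨ D = bernoulliLaws)
    (hδ0 : 0 < δ) (hδ : δ < 1 / 2) (hν : ∀ i j, ν i j ∈ bernoulliLaws) (hreg : IsRegular ν θ)
    (hfin : π.expectedSamples ν ≠ ⊤) (hθ0 : 0 < θ) (hθ1 : θ < 1)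
    {i b : Fin N} (hb : bestArm ν θ = some b) (hib : armMean ν i < armMean ν b)
    (hb1 : armMean ν b < 1) {d : ℝ} (hd : armMean ν b - armMean ν i ≤ 2 * d)
    (hd' : ∀ j, θ - attrMean ν i j ≤ d) :
    Real.log (1 / (2.4 * δ)) ≤
      armSamples π ν i * (d ^ 2 / (θ * (1 - θ) * (1 - armMean ν b) ^ 2 / 4)) := by
  set x := armMean ν i with hx
  set y := armMean ν b with hy
  have hib' : bestArm ν θ ≠ some i := by
    rw [hb]; intro h; rw [Option.some_inj] at h; rw [hx, hy, h] at hib; exact lt_irrefl _ hib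
  have hx0 : 0 ≤ x := (armMean_mem_Icc (fun i j => bernoulliLaws_subset_unitLaws (hν i j)) i).1
  have hx1 : 0 < 1 - x := by linarith
  have hy1 : 0 < 1 - y := by linarith
  have h1θ : 0 < 1 - θ := by linarith
  have hd0 : 0 < d := by linarith
  have h1s : ∀ η, 1 - (y + η - x) / (1 - x) = (1 - y - η) / (1 - x) := fun η => by
    field_simp; ring
  have hF : ContinuousAt (fun η => armSamples π ν i *
      max ((d + η) ^ 2 / ((θ + η) * (1 - (θ + η))))
        (((y + η - x) / (1 - x)) ^ 2 / ((θ + η) * (1 - (y + η - x) / (1 - x))))) 0 := by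
    refine continuousAt_const.mul (Filter.Tendsto.max
      (ContinuousAt.div (by fun_prop) (by fun_prop) ?_)
      (ContinuousAt.div (by fun_prop) (by fun_prop) ?_))
    · simp only [add_zero]; positivity
    · rw [h1s]; simp only [add_zero, sub_zero]; positivity
  have key := le_apply_zero_of_forall_pos (c := Real.log (1 / (2.4 * δ)))
    (lt_min h1θ hy1) hF fun η hη0 hη1 => ?_
  · refine key.trans (mul_le_mul_of_nonneg_left ?_ (armSamples_nonneg i))
    simp only [add_zero]
    have h := h1s 0
    simp only [add_zero, sub_zero] at h
    rw [h]
    have hy2 : (1 - y) ^ 2 ≤ 1 := by nlinarith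
    refine max_le ?_ ?_
    · refine div_le_div_of_nonneg_left (by positivity) (by positivity) ?_
      have : 0 < θ * (1 - θ) := by positivity
      nlinarith
    · have e : ((y - x) / (1 - x)) ^ 2 / (θ * ((1 - y) / (1 - x))) =
          (y - x) ^ 2 / (θ * (1 - x) * (1 - y)) := by field_simp
      have e' : d ^ 2 / (θ * (1 - θ) * (1 - y) ^ 2 / 4) =
          (2 * d) ^ 2 / (θ * (1 - θ) * (1 - y) ^ 2) := by field_simp; ring
      rw [e, e']
      have h1 : (y - x) ^ 2 ≤ (2 * d) ^ 2 := by
        refine pow_le_pow_left₀ (by linarith) hd 2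
      have h2 : θ * (1 - θ) * (1 - y) ^ 2 ≤ θ * (1 - x) * (1 - y) := by
        calc θ * (1 - θ) * (1 - y) ^ 2 = θ * ((1 - θ) * (1 - y)) * (1 - y) := by ring
          _ ≤ θ * (1 - x) * (1 - y) := by
            gcongr
            nlinarith
      gcongr
  have hη1' := hη1.trans_le (min_le_left _ _)
  have hη2' := hη1.trans_le (min_le_right _ _)
  refine log_le_of_raise hπ hD hδ0 hδ hν hreg hfin hθ0 hib' (by linarith) (by linarith)
    (div_nonneg (by linarith) hx1.le) ?_ (fun j => by linarith [hd' j]) ?_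
  · rw [div_lt_one hx1]; linarith
  · intro b' hb'
    obtain rfl : b' = b := by rw [hb] at hb'; exact (Option.some.inj hb').symm
    set s := (y + η - x) / (1 - x) with hs
    have hsum : ∑ j, (attrMean ν i j + (1 - attrMean ν i j) * s) = (x + (1 - x) * s) * M := by
      have : ∑ j, attrMean ν i j = x * M := by
        rw [hx, armMean, div_mul_cancel₀ _ card_pos_real.ne']
      rw [Finset.sum_add_distrib, ← Finset.sum_mul, Finset.sum_sub_distrib, this]
      simp; ring
    rw [lt_div_iff₀ card_pos_real]
    calc y * M < (x + (1 - x) * s) * M := by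
          refine mul_lt_mul_of_pos_right ?_ card_pos_real
          rw [hs, mul_div_cancel₀ _ hx1.ne']; linarith
      _ ≤ _ := by rw [← hsum]; exact Finset.sum_le_sum fun j _ => le_max_right _ _

/-- If the best arm becomes infeasible, then the instance is regular and has another answer, once
the arms of a suitable set of feasible arms are raised a little to break ties. -/
lemma exists_raise_set {b : Fin N} (hb : bestArm ν θ = some b) (hb1 : armMean ν b < 1)
    (hθ1 : θ < 1) (hIcc : ∀ i j, attrMean ν i j ≤ 1) :
    ∃ W : Set (Fin N), W ⊆ feasible ν θ ∧ b ∉ W ∧ ∀ (η : ℝ) (ν' : Env N M), 0 < η →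
      (∃ j, attrMean ν' b j < θ) →
      (∀ l ∈ W, ∀ j, attrMean ν' l j = attrMean ν l j + (1 - attrMean ν l j) * η) →
      (∀ l ∉ W, l ≠ b → ∀ j, attrMean ν' l j = attrMean ν l j) →
      IsRegular ν' θ ∧ bestArm ν θ ≠ bestArm ν' θ := by
  have hfeas : ∀ {ν' : Env N M} {l : Fin N}, (∀ j, attrMean ν' l j = attrMean ν l j) →
      l ∈ feasible ν' θ → l ∈ feasible ν θ := fun h hl => by
    rw [mem_feasible_iff] at hl ⊢
    exact fun j => h j ▸ hl j
  by_cases hne : (feasible ν θ \ {b}).Nonempty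
  · obtain ⟨k, ⟨hkf, hkb⟩, hkmax⟩ :=
      Set.exists_max_image (feasible ν θ \ {b}) (armMean ν) (Set.toFinite _) hne
    have hkb' : k ≠ b := hkb
    refine ⟨{k}, Set.singleton_subset_iff.2 hkf, fun h => hkb' h.symm, ?_⟩
    rintro η ν' hη ⟨j₀, hj₀⟩ hW hWc
    have hk := hW k rfl
    have hk1 : armMean ν k < 1 := ((bestArm_eq_some_iff.1 hb).2 k hkf hkb').trans hb1
    have hkarm : armMean ν k < armMean ν' k := by
      simp only [armMean, hk]
      refine div_lt_div_of_pos_right ?_ card_pos_real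
      rw [Finset.sum_add_distrib, ← Finset.sum_mul, Finset.sum_sub_distrib]
      have : (∑ j, attrMean ν k j) < M := by
        rwa [armMean, div_lt_one card_pos_real] at hk1
      have : 0 < (∑ _j : Fin M, (1 : ℝ)) - ∑ j, attrMean ν k j := by simpa using this
      nlinarith
    obtain ⟨h1, h2⟩ := isRegular_of_forall_lt (ν := ν') (θ := θ) (b := k)
      (fun j => by
        rw [hk]
        have := mem_feasible_iff.1 hkf j
        rcases (hIcc k j).eq_or_lt with h | h
        · rw [h]; linarith
        · nlinarith) fun l hl hlk => by
        have hlb : l ≠ b := by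
          rintro rfl
          exact (mem_feasible_iff.1 hl j₀).not_gt hj₀
        have hla := hWc l hlk hlb
        rw [armMean_congr hla]
        exact (hkmax l ⟨hfeas hla hl, hlb⟩).trans_lt hkarm
    refine ⟨h1, ?_⟩
    rw [hb, h2, Ne, Option.some_inj]
    exact hkb'.symm
  · rw [Set.not_nonempty_iff_eq_empty] at hne
    refine ⟨∅, Set.empty_subset _, Set.notMem_empty _, ?_⟩
    rintro η ν' - ⟨j₀, hj₀⟩ - hWc
    obtain ⟨h1, h2⟩ := isRegular_of_infeasible (ν := ν') (θ := θ) fun l => by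
      by_cases hlb : l = b
      · exact ⟨j₀, hlb ▸ hj₀⟩
      · by_contra! hcon
        have : l ∈ feasible ν θ \ {b} :=
          ⟨hfeas (hWc l (Set.notMem_empty l) hlb) (mem_feasible_iff.2 hcon), hlb⟩
        rw [hne] at this
        exact this
    exact ⟨h1, by rw [hb, h2]; simp⟩

/-- The samples of the best arm that are needed to see that it is feasible. -/
lemma log_le_of_best (hπ : π.IsPAC D θ δ) (hD : D = unitLaws ∨ D = bernoulliLaws)
    (hδ0 : 0 < δ) (hδ : δ < 1 / 2) (hν : ∀ i j, ν i j ∈ bernoulliLaws) (hreg : IsRegular ν θ)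
    (hfin : π.expectedSamples ν ≠ ⊤) (hθ0 : 0 < θ) (hθ1 : θ < 1) {b : Fin N}
    (hb : bestArm ν θ = some b) (hb1 : armMean ν b < 1) :
    Real.log (1 / (2.4 * δ)) ≤ armSamples π ν b * (attrGap ν θ b ^ 2 / (θ * (1 - θ))) := by
  classical
  have hIcc := fun i j => attrMean_mem_Icc (fun i j => bernoulliLaws_subset_unitLaws (hν i j)) i j
  have hbf : θ ≤ minAttrMean ν b := (bestArm_eq_some_iff.1 hb).1
  have hgap : attrGap ν θ b = minAttrMean ν b - θ := abs_of_nonneg (by linarith)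
  obtain ⟨j₀, hj₀⟩ := exists_minAttrMean_eq (ν := ν) b
  obtain ⟨W, hWf, hbW, hW⟩ := exists_raise_set hb hb1 hθ1 fun i j => (hIcc i j).2
  set E := ∑ l, armSamples π ν l with hE
  have hne : θ * (1 - θ) ≠ 0 := mul_ne_zero hθ0.ne' (by linarith)
  have hF : ContinuousAt (fun η => armSamples π ν b *
      ((attrGap ν θ b + η) ^ 2 / ((θ - η) * (1 - (θ - η)))) + E * (η ^ 2 / (θ * (1 - η)))) 0 := by
    refine (continuousAt_const.mul (ContinuousAt.div (by fun_prop) (by fun_prop) ?_)).add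
      (continuousAt_const.mul (ContinuousAt.div (by fun_prop) (by fun_prop) ?_))
    · simpa using hne
    · simpa using hθ0.ne'
  have key := le_apply_zero_of_forall_pos (c := Real.log (1 / (2.4 * δ))) (lt_min hθ0 one_pos) hF
    fun η hη0 hη1 => ?_
  · simpa using key
  have hηθ : η < θ := hη1.trans_le (min_le_left _ _)
  have hη1' : η < 1 := hη1.trans_le (min_le_right _ _)
  set m : Fin N → Fin M → ℝ := fun l j =>
    if l = b then (if j = j₀ then θ - η else attrMean ν l j)
    else if l ∈ W then attrMean ν l j + (1 - attrMean ν l j) * η else attrMean ν l j with hm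
  have hmW : ∀ l ∈ W, ∀ j, m l j = attrMean ν l j + (1 - attrMean ν l j) * η := fun l hl j => by
    have : l ≠ b := fun h => hbW (h ▸ hl)
    simp [hm, this, hl]
  have hmc : ∀ l ∉ W, l ≠ b → ∀ j, m l j = attrMean ν l j := fun l hl hlb j => by
    simp [hm, hlb, hl]
  have hmb : m b j₀ = θ - η := by simp [hm]
  have hmb' : ∀ j ≠ j₀, m b j = attrMean ν b j := fun j hj => by simp [hm, hj]
  refine (hπ.log_le_of_means hD hδ0 hδ hν hreg hfin m ?_ ?_).trans ?_
  · intro l j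
    by_cases hlb : l = b
    · subst hlb
      by_cases hj : j = j₀
      · subst hj; rw [hmb]; exact Or.inr ⟨by linarith, by linarith⟩
      · exact Or.inl (hmb' j hj)
    · by_cases hl : l ∈ W
      · rw [hmW l hl]
        obtain ⟨h0, h1⟩ := hIcc l j
        rcases h1.eq_or_lt with h1 | h1
        · left; rw [h1]; ring
        · exact Or.inr ⟨by nlinarith, by nlinarith⟩
      · exact Or.inl (hmc l hl hlb j)
  · intro ν' hν'
    exact hW η ν' hη0 ⟨j₀, by rw [hν', hmb]; linarith⟩ (fun l hl j => by rw [hν', hmW l hl])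
      fun l hl hlb j => by rw [hν', hmc l hl hlb]
  · set X := (attrGap ν θ b + η) ^ 2 / ((θ - η) * (1 - (θ - η))) with hX
    set Y := η ^ 2 / (θ * (1 - η)) with hY
    have hX0 : 0 ≤ X := div_nonneg (sq_nonneg _) (mul_nonneg (by linarith) (by linarith))
    have hY0 : 0 ≤ Y := div_nonneg (sq_nonneg _) (mul_nonneg hθ0.le (by linarith))
    have hterm : ∀ l, ∑ j, (π.samplesOf ν (l, j)).toReal *
        ((attrMean ν l j - m l j) ^ 2 / (m l j * (1 - m l j))) ≤
          armSamples π ν l * ((if l = b then X else 0) + Y) := by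
      intro l
      rw [armSamples, Finset.sum_mul]
      refine Finset.sum_le_sum fun j _ => mul_le_mul_of_nonneg_left ?_ ENNReal.toReal_nonneg
      by_cases hlb : l = b
      · subst hlb
        rw [if_pos rfl]
        by_cases hj : j = j₀
        · subst hj
          have : attrMean ν l j - m l j = attrGap ν θ l + η := by rw [hmb, hgap, hj₀]; ring
          rw [this, hmb]
          linarith
        · rw [hmb' j hj, sub_self]
          simpa using add_nonneg hX0 hY0
      · rw [if_neg hlb, zero_add]
        by_cases hl : l ∈ W
        · have hθl := mem_feasible_iff.1 (hWf hl) j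
          obtain ⟨h0, h1⟩ := hIcc l j
          have h := chiSq_raise_le h0 h1 hθ0 hθ1 hη0.le hη1' (r := 0) (by linarith)
          rw [max_eq_right (by nlinarith)] at h
          rw [hmW l hl]
          refine h.trans (max_le ?_ le_rfl)
          simpa using hY0
        · rw [hmc l hl hlb, sub_self]
          simpa using hY0
    refine (Finset.sum_le_sum fun l _ => hterm l).trans (le_of_eq ?_)
    simp only [mul_add, Finset.sum_add_distrib, hE, Finset.sum_mul]
    simp

lemma mul_one_div_le {Λ T c d : ℝ} (hc : 0 < c) (hT : 0 ≤ T) (h : Λ ≤ T * (d ^ 2 / c)) :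
    Λ * c * (1 / d ^ 2) ≤ T := by
  rcases eq_or_ne d 0 with rfl | hd
  · simpa using hT
  · have hd2 : 0 < d ^ 2 := by positivity
    calc Λ * c * (1 / d ^ 2) ≤ (T * (d ^ 2 / c)) * c * (1 / d ^ 2) := by gcongr
      _ = T := by field_simp

lemma mem_subopt_iff {b i : Fin N} (hb : bestArm ν θ = some b) :
    i ∈ subopt ν θ ↔ armMean ν i < armMean ν b := by
  simp [subopt, hb]

lemma bestMean_eq {b : Fin N} (hb : bestArm ν θ = some b) : bestMean ν θ = armMean ν b := by
  simp [bestMean, hb]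

lemma gap_eq {b i : Fin N} (hb : bestArm ν θ = some b) (hi : i ∈ subopt ν θ) :
    gap ν θ i = armMean ν b - armMean ν i := by
  rw [gap, bestMean_eq hb, abs_of_pos]
  linarith [(mem_subopt_iff hb).1 hi]

lemma gap_le_effGap (i : Fin N) : gap ν θ i / 2 ≤ effGap ν θ i := by
  unfold effGap
  split_ifs
  exacts [le_rfl, le_max_left _ _]

lemma exists_bestArm_of_subopt_nonempty (h : (subopt ν θ).Nonempty) :
    ∃ b, bestArm ν θ = some b := by
  rcases hb : bestArm ν θ with _ | b
  · simp [subopt, hb] at h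
  · exact ⟨b, rfl⟩

lemma bestGap_le_gap (h : (subopt ν θ).Nonempty) {i : Fin N} (hi : i ∈ subopt ν θ) :
    bestGap ν θ h ≤ gap ν θ i := by
  obtain ⟨b, hb⟩ := exists_bestArm_of_subopt_nonempty h
  rw [gap_eq hb hi, bestGap, bestMean_eq hb, abs_of_nonneg]
  · linarith [Finset.le_sup' (armMean ν) hi]
  · rw [sub_nonneg]
    exact Finset.sup'_le _ _ fun k hk => ((mem_subopt_iff hb).1 hk).le

lemma competitorRatio_nonneg : 0 ≤ competitorRatio ν θ := by
  unfold competitorRatio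
  split_ifs <;> positivity

lemma competitorRatio_le_one : competitorRatio ν θ ≤ 1 := by
  unfold competitorRatio
  split_ifs with h
  · have h0 : 0 ≤ bestGap ν θ h / 2 := div_nonneg (abs_nonneg _) zero_le_two
    have h1 : bestGap ν θ h / 2 ≤ (subopt ν θ).inf' h (effGap ν θ) :=
      Finset.le_inf' _ _ fun i hi => le_trans (by linarith [bestGap_le_gap h hi]) (gap_le_effGap i)
    exact pow_le_one₀ (div_nonneg h0 (h0.trans h1)) (div_le_one_of_le₀ h1 (h0.trans h1))
  · exact le_rfl

/-- The lower bound with the explicit constant for Bernoulli rewards. -/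
lemma bernoulli_lower_bound (hπ : π.IsPAC D θ δ) (hD : D = unitLaws ∨ D = bernoulliLaws)
    (hδ0 : 0 < δ) (hδ : δ < 1 / 2) (hlog : 0 ≤ Real.log (1 / (2.4 * δ)))
    (hν : ∀ i j, ν i j ∈ bernoulliLaws) (hreg : IsRegular ν θ)
    (hfin : π.expectedSamples ν ≠ ⊤) (hθ0 : 0 < θ) (hθ1 : θ < 1) (hb1 : bestMean ν θ < 1) :
    Real.log (1 / (2.4 * δ)) * bernoulliConst ν θ * hardness ν θ ≤
      (π.expectedSamples ν).toReal := by
  classical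
  have hν1 : ∀ i j, ν i j ∈ unitLaws := fun i j => bernoulliLaws_subset_unitLaws (hν i j)
  set Λ := Real.log (1 / (2.4 * δ)) with hΛ
  set T := armSamples π ν with hT
  have hT0 : ∀ i, 0 ≤ T i := fun i => armSamples_nonneg i
  have hTsum : ∑ i, T i ≤ (π.expectedSamples ν).toReal := sum_armSamples_le hfin
  have hbm0 : 0 ≤ bestMean ν θ := by
    rcases hb : bestArm ν θ with _ | b
    · simp [bestMean, hb]
    · rw [bestMean_eq hb]; exact (armMean_mem_Icc hν1 b).1
  have h1θ : 0 < 1 - θ := by linarith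
  have h1b : 0 < 1 - bestMean ν θ := by linarith
  set c := θ * (1 - θ) * (1 - bestMean ν θ) ^ 2 / 4 with hc
  have hc0 : 0 < c := by positivity
  have hcle : c ≤ θ * (1 - θ) := by
    have h1 : (1 - bestMean ν θ) ^ 2 ≤ 1 := by nlinarith
    have h2 : 0 < θ * (1 - θ) := by positivity
    rw [hc]; nlinarith
  have hweak : ∀ {i : Fin N} {d : ℝ}, Λ ≤ T i * (d ^ 2 / (θ * (1 - θ))) →
      Λ * c * (1 / d ^ 2) ≤ T i := fun {i d} h => by
    refine mul_one_div_le hc0 (hT0 i) (h.trans (mul_le_mul_of_nonneg_left ?_ (hT0 i)))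
    exact div_le_div_of_nonneg_left (sq_nonneg d) hc0 hcle
  have hS : ∀ i ∈ subopt ν θ, Λ * c * (1 / effGap ν θ i ^ 2) ≤ T i := by
    intro i hi
    obtain ⟨b, hb⟩ := exists_bestArm_of_subopt_nonempty ⟨i, hi⟩
    refine mul_one_div_le hc0 (hT0 i) ?_
    rw [hc, bestMean_eq hb]
    refine log_le_of_lt hπ hD hδ0 hδ hν hreg hfin hθ0 hθ1 hb ((mem_subopt_iff hb).1 hi)
      (bestMean_eq hb ▸ hb1) ?_ ?_
    · linarith [gap_le_effGap (ν := ν) (θ := θ) i, gap_eq hb hi]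
    · intro j
      by_cases hf : i ∈ feasible ν θ
      · have h1 := mem_feasible_iff.1 hf j
        have h2 : 0 ≤ gap ν θ i := abs_nonneg _
        linarith [gap_le_effGap (ν := ν) (θ := θ) i]
      · rw [effGap, if_neg hf]
        refine le_trans ?_ (le_max_right _ _)
        have h1 : θ - minAttrMean ν i ≤ attrGap ν θ i := by
          rw [attrGap, abs_sub_comm]; exact le_abs_self _
        linarith [minAttrMean_le (ν := ν) i j]
  have hR : ∀ i ∈ risky ν θ, i ∉ feasible ν θ → Λ * c * (1 / attrGap ν θ i ^ 2) ≤ T i := by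
    intro i hi hf
    refine hweak (log_le_of_risky hπ hD hδ0 hδ hν hreg hfin hθ0 hθ1 hf fun b hb => ?_)
    by_contra! hlt
    simp only [risky, Finset.mem_sdiff, Finset.mem_union, not_or] at hi
    exact hi.2.1 ((mem_subopt_iff hb).2 hlt)
  have hB : ∀ b, bestArm ν θ = some b → Λ * c * (1 / attrGap ν θ b ^ 2) ≤ T b := fun b hb =>
    hweak (log_le_of_best hπ hD hδ0 hδ hν hreg hfin hθ0 hθ1 hb (bestMean_eq hb ▸ hb1))
  set ρ := competitorRatio ν θ with hρ
  have hρ0 : 0 ≤ ρ := competitorRatio_nonneg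
  have hρ1 : ρ ≤ 1 := competitorRatio_le_one
  have hΛc : 0 ≤ Λ * c := mul_nonneg hlog hc0.le
  have hbest : Λ * c * (ρ * bestTerm ν θ) ≤ ∑ i ∈ (bestArm ν θ).toFinset, T i + ∑ i, T i := by
    have hsum0 : 0 ≤ ∑ i, T i := Finset.sum_nonneg fun i _ => hT0 i
    rcases hb : bestArm ν θ with _ | b
    · simpa [bestTerm, hb] using hsum0
    have hattr : Λ * c * (ρ * (1 / attrGap ν θ b ^ 2)) ≤ T b + ∑ i, T i := by
      have : ρ * (1 / attrGap ν θ b ^ 2) ≤ 1 / attrGap ν θ b ^ 2 :=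
        mul_le_of_le_one_left (by positivity) hρ1
      linarith [mul_le_mul_of_nonneg_left this hΛc, hB b hb]
    simp only [Option.toFinset_some, Finset.sum_singleton, bestTerm, hb]
    split_ifs with h
    · rcases min_choice (bestGap ν θ h / 2) (attrGap ν θ b) with hmin | hmin
      · rw [hmin]
        obtain ⟨i₀, hi₀, hinf⟩ := Finset.exists_mem_eq_inf' h (effGap ν θ)
        have h1 : ρ * (1 / (bestGap ν θ h / 2) ^ 2) ≤ 1 / effGap ν θ i₀ ^ 2 := by
          rw [hρ, competitorRatio, dif_pos h, hinf, div_pow, div_mul_eq_mul_div]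
          refine div_le_div_of_nonneg_right ?_ (sq_nonneg _)
          rw [mul_one_div]
          exact div_self_le_one _
        have h2 : T i₀ ≤ ∑ i, T i := Finset.single_le_sum (fun i _ => hT0 i) (Finset.mem_univ i₀)
        linarith [mul_le_mul_of_nonneg_left h1 hΛc, hS i₀ hi₀, hT0 b]
      · rw [hmin]; exact hattr
    · exact hattr
  have hterm : ∀ {x y : ℝ}, 0 ≤ x → Λ * c * x ≤ y → Λ * c * (ρ * x) ≤ y := fun {x y} hx h =>
    (mul_le_mul_of_nonneg_left (mul_le_of_le_one_left hx hρ1) hΛc).trans h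
  have hsumS : Λ * c * (ρ * ((∑ i ∈ (subopt ν θ).filter (· ∈ feasible ν θ), 1 / (gap ν θ i / 2) ^ 2)
      + ∑ i ∈ (subopt ν θ).filter (· ∉ feasible ν θ),
        1 / (max (gap ν θ i / 2) (attrGap ν θ i)) ^ 2)) ≤ ∑ i ∈ subopt ν θ, T i := by
    have h1 : (∑ i ∈ (subopt ν θ).filter (· ∈ feasible ν θ), 1 / (gap ν θ i / 2) ^ 2)
        + ∑ i ∈ (subopt ν θ).filter (· ∉ feasible ν θ),
          1 / (max (gap ν θ i / 2) (attrGap ν θ i)) ^ 2 =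
          ∑ i ∈ subopt ν θ, 1 / effGap ν θ i ^ 2 := by
      rw [← Finset.sum_filter_add_sum_filter_not (subopt ν θ) (· ∈ feasible ν θ)]
      congr 1
      · exact Finset.sum_congr rfl fun i hi => by rw [effGap, if_pos (Finset.mem_filter.1 hi).2]
      · exact Finset.sum_congr rfl fun i hi => by rw [effGap, if_neg (Finset.mem_filter.1 hi).2]
    rw [h1]
    refine hterm (Finset.sum_nonneg fun i _ => by positivity) ?_
    rw [Finset.mul_sum]
    exact Finset.sum_le_sum hS
  have hsumR : Λ * c * (ρ * ∑ i ∈ (risky ν θ).filter (· ∉ feasible ν θ), 1 / attrGap ν θ i ^ 2) ≤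
      ∑ i ∈ risky ν θ, T i := by
    refine hterm (Finset.sum_nonneg fun i _ => by positivity) ?_
    rw [Finset.mul_sum]
    refine (Finset.sum_le_sum fun i hi => hR i (Finset.mem_filter.1 hi).1
      (Finset.mem_filter.1 hi).2).trans ?_
    exact Finset.sum_le_sum_of_subset_of_nonneg (Finset.filter_subset _ _) fun i _ _ => hT0 i
  have hpart : ∑ i ∈ subopt ν θ, T i + ∑ i ∈ risky ν θ, T i + ∑ i ∈ (bestArm ν θ).toFinset, T i =
      ∑ i, T i := by
    have hdisj : Disjoint (subopt ν θ) (bestArm ν θ).toFinset := by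
      refine Finset.disjoint_left.2 fun i hi hib => ?_
      have hib' : bestArm ν θ = some i := by simpa using hib
      exact lt_irrefl _ ((mem_subopt_iff hib').1 hi)
    rw [← Finset.sum_sdiff (Finset.subset_univ (subopt ν θ ∪ (bestArm ν θ).toFinset)),
      Finset.sum_union hdisj, risky]
    ring
  have hconst : bernoulliConst ν θ ≤ c / 2 * ρ := by
    rw [bernoulliConst, hc]
    refine mul_le_mul_of_nonneg_right ?_ hρ0
    have : 0 ≤ θ * (1 - θ) * (1 - bestMean ν θ) ^ 2 := by positivity
    nlinarith
  have hH : 0 ≤ hardness ν θ := hardness_nonneg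
  calc Λ * bernoulliConst ν θ * hardness ν θ ≤ Λ * (c / 2 * ρ) * hardness ν θ := by gcongr
    _ ≤ ∑ i, T i := by
      rw [hardness]
      linarith
    _ ≤ _ := hTsum

end GroupedBandit

end

open GroupedBandit in
theorem theorem1 (N M : ℕ) [NeZero N] [NeZero M] (D : Set (MeasureTheory.ProbabilityMeasure ℝ))
    (hD : D = unitLaws ∨ D = bernoulliLaws) (θ : ℝ) (hθ0 : 0 < θ ∨ 2 ≤ N) (hθ1 : θ < 1)
    (ν : Env N M) (hν : ∀ i j, ν i j ∈ D) (hreg : IsRegular ν θ) :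
    ∃ C : ℝ, 0 < C ∧ ((∀ i j, ν i j ∈ bernoulliLaws) → bernoulliConst ν θ ≤ C) ∧
      ∀ δ : ℝ, 0 < δ → δ < 1 → ∀ π : Policy N M, π.IsPAC D θ δ →
        ENNReal.ofReal (Real.log (1 / (2.4 * δ)) * C * hardness ν θ) ≤ π.expectedSamples ν := by
  obtain ⟨C₀, hC₀, hbound⟩ := exists_lower_bound hD hθ0 hθ1 hν hreg
  have hH : 0 ≤ hardness ν θ := hardness_nonneg
  have hmain : ∃ C : ℝ, 0 < C ∧ ((∀ i j, ν i j ∈ bernoulliLaws) → bernoulliConst ν θ ≤ C) ∧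
      ∀ δ : ℝ, 0 < δ → δ < 1 / 2 → 0 ≤ Real.log (1 / (2.4 * δ)) →
        ∀ π : Policy N M, π.IsPAC D θ δ → π.expectedSamples ν ≠ ⊤ →
          Real.log (1 / (2.4 * δ)) * C * hardness ν θ ≤ (π.expectedSamples ν).toReal := by
    by_cases hle : (∀ i j, ν i j ∈ bernoulliLaws) → bernoulliConst ν θ ≤ C₀
    · exact ⟨C₀, hC₀, hle, hbound⟩
    push Not at hle
    obtain ⟨hber, hlt⟩ := hle
    have hpos : 0 < bernoulliConst ν θ := hC₀.trans hlt
    refine ⟨bernoulliConst ν θ, hpos, fun _ => le_rfl, ?_⟩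
    have hb1 : bestMean ν θ ≤ 1 := by
      rcases hb : bestArm ν θ with _ | b
      · simp [bestMean, hb]
      · rw [bestMean_eq hb]
        exact (armMean_mem_Icc (fun i j => bernoulliLaws_subset_unitLaws (hber i j)) b).2
    have hb1' : bestMean ν θ < 1 := by
      refine hb1.lt_of_ne fun h => hpos.ne' ?_
      simp [bernoulliConst, h]
    have hθ : 0 < θ := by
      by_contra! hθ
      refine hpos.not_ge ?_
      rw [bernoulliConst]
      refine mul_nonpos_of_nonpos_of_nonneg ?_ competitorRatio_nonneg
      have h1 : θ * (1 - θ) ≤ 0 := mul_nonpos_of_nonpos_of_nonneg hθ (by linarith)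
      have h2 : 0 ≤ (1 - bestMean ν θ) ^ 3 := pow_nonneg (by linarith) 3
      linarith [mul_nonpos_of_nonpos_of_nonneg h1 h2]
    intro δ hδ0 hδ hlog π hπ hfin
    exact bernoulli_lower_bound hπ hD hδ0 hδ hlog hber hreg hfin hθ hθ1 hb1'
  obtain ⟨C, hC, hber, hbd⟩ := hmain
  refine ⟨C, hC, hber, fun δ hδ0 _ π hπ => ?_⟩
  rcases le_or_gt (Real.log (1 / (2.4 * δ))) 0 with hlog | hlog
  · rw [ENNReal.ofReal_of_nonpos]
    · exact zero_le
    · exact mul_nonpos_of_nonpos_of_nonneg (mul_nonpos_of_nonpos_of_nonneg hlog hC.le) hH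
  by_cases hfin : π.expectedSamples ν = ⊤
  · rw [hfin]; exact le_top
  have hδ : δ < 1 / 2 := by
    have h1 : 1 < 1 / (2.4 * δ) := by
      by_contra! h
      exact hlog.not_ge (Real.log_nonpos (by positivity) h)
    rw [lt_div_iff₀ (by positivity)] at h1
    linarith
  rw [ENNReal.ofReal_le_iff_le_toReal hfin]
  exact hbd δ hδ0 hδ hlog.le π hπ hfin
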